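/- Let $N_t > N_r$ and let $\mathbf H$ be an $N_r\times N_t$ Rayleigh fading channel matrix, i.e. its entries are independent circularly symmetric complex Gaussian variables of mean $0$ and variance $1$. Fix a transmit antenna $j$, let $\mathbf h$ be the $j$-th column of $\mathbf H$ and $\mathbf K$ the matrix $\mathbf H$ with that column removed. For an SNR $\rho>0$, the SINR of the MMSE receiver is $$\gamma=\frac{\rho}{N_t}\,\mathbf h^\dagger\Big(\frac{\rho}{N_t}\mathbf K\mathbf K^\dagger+\mathbf I_{N_r}\Big)^{-1}\mathbf h ,$$ the normalized SINR is $X=N_t\gamma/\rho$, and the round-robin MMSE maximum sum-rate (in bits) is $$R^{\rm rr}_{\rm MMSE}(\rho)=N_t\,{\rm E}\Big[\log_2\Big(1+\frac{\rho}{N_t}X\Big)\Big].$$ This expectation exists (is finite) for every $\rho>0$, and as $\rho\to\infty$ $$R^{\rm rr}_{\rm MMSE}(\rho)\;\longrightarrow\;\frac{1}{\ln 2}\sum_{k=0}^{N_r-1}\frac{N_t}{N_t-k-1};$$ that is, the sum-rate measured in nats, $\ln 2\cdot R^{\rm rr}_{\rm MMSE}(\rho)$, converges to $\sum_{k=0}^{N_r-1}\frac{N_t}{N_t-k-1}$.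 The difference between $R^{\rm rr}_{\rm MMSE}(\rho)$ and its limit is $O\!\left(\frac{\log\rho}{\rho}\right)$ for all $N_t>N_r$. If $N_t\ge N_r+2$ it is moreover $O\!\left(\frac1\rho\right)$, and in particular $o\!\left(\frac{\log\rho}{\rho}\right)$. -/

import Mathlib

open MeasureTheory ProbabilityTheory Filter Topology Asymptotics
open scoped Matrix

noncomputable section

/-- The circularly symmetric standard complex Gaussian law `CN(0, 1)`: the real and imaginary
parts are independent real Gaussians with mean `0` and variance `1/2`. -/
def stdComplexGaussian : Measure ℂ :=
  ((gaussianReal 0 (1 / 2)).prod (gaussianReal 0 (1 / 2))).map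
    (fun p : ℝ × ℝ => (⟨p.1, p.2⟩ : ℂ))

instance instIsProbabilityMeasureStdComplexGaussian :
    IsProbabilityMeasure stdComplexGaussian :=
  Measure.isProbabilityMeasure_map
    (Complex.measurableEquivRealProd.symm.measurable.aemeasurable)

/-- The law of the `Nr × Nt` Rayleigh fading channel matrix
`CN_{Nr, Nt}(0, I ⊗ I)`: all entries are independent with law `CN(0, 1)`. -/
def rayleighLaw (Nr Nt : ℕ) : Measure (Fin Nr → Fin Nt → ℂ) :=
  Measure.pi fun _ => Measure.pi fun _ => stdComplexGaussian

instance instIsProbabilityMeasureRayleighLaw (Nr Nt : ℕ) :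
    IsProbabilityMeasure (rayleighLaw Nr Nt) := by
  unfold rayleighLaw
  infer_instance

/-- The matrix `H` with its `k`-th column removed. -/
def removeCol {Nr Nt : ℕ} (H : Matrix (Fin Nr) (Fin Nt) ℂ) (k : Fin Nt) :
    Matrix (Fin Nr) {j : Fin Nt // j ≠ k} ℂ :=
  H.submatrix id Subtype.val

/-- The received SINR of the `k`-th stream with an MMSE receiver,
`γ = (ρ / Nt) h† ((ρ / Nt) K K† + I)⁻¹ h`, where `h` is the `k`-th column of `H` and `K` is `H`
with that column removed. For `0 ≤ ρ` the matrix is positive definite, so that the inverse is a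
true inverse and the complex number whose real part is taken is real and nonnegative. -/
def mmseSINR {Nr Nt : ℕ} (H : Matrix (Fin Nr) (Fin Nt) ℂ) (k : Fin Nt) (ρ : ℝ) : ℝ :=
  (ρ / Nt) *
    (star (H.col k) ⬝ᵥ
      ((((ρ / Nt : ℝ) : ℂ) • (removeCol H k * (removeCol H k)ᴴ) + 1)⁻¹ *ᵥ H.col k)).re

/-- The normalized SINR `X = Nt γ / ρ`. -/
def mmseNormalizedSINR {Nr Nt : ℕ} (H : Matrix (Fin Nr) (Fin Nt) ℂ) (k : Fin Nt) (ρ : ℝ) : ℝ :=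
  Nt * mmseSINR H k ρ / ρ

/-- The rate `log₂ (1 + (ρ / Nt) X)` of the `k`-th stream, in bits. -/
def mmseRate {Nr Nt : ℕ} (H : Matrix (Fin Nr) (Fin Nt) ℂ) (k : Fin Nt) (ρ : ℝ) : ℝ :=
  Real.logb 2 (1 + ρ / Nt * mmseNormalizedSINR H k ρ)

/-- The round-robin MMSE maximum sum-rate `R(ρ) = Nt E[log₂ (1 + (ρ / Nt) X)]`, in bits, where
`X` is the normalized SINR at an arbitrary transmit antenna `k`. -/
def mmseSumRate (Nr Nt : ℕ) (k : Fin Nt) (ρ : ℝ) : ℝ :=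
  Nt * ∫ H, mmseRate (Matrix.of H) k ρ ∂(rayleighLaw Nr Nt)

end

/-! Put c = ρ/Nt, m = Nr, n = Nt - Nr - 1. As HH† = KK† + hh†, the matrix determinant lemma gives 1
+ γ = det(1 + cHH†) / det(1 + cKK†) (`one_add_mmseSINR`), so the rate is a difference of two
log-determinants of Gaussian Gram matrices; K is Gaussian with one column fewer. For such a Gram
matrix A, log det(1 + cA) = m log c + log det A + log det(1 + (cA)⁻¹). The first terms cancel.
Rotating rows onto coordinate axes makes det A a product of independent Gamma variables
(`identDistrib_det_rowGram`), and E log increases by 1/k from Gamma shape k to shape k + 1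
(`integral_log_gammaLaw_succ`), which yields the limit. The last term is at most m Σᵢ log(1 +
c⁻¹(A⁻¹)ᵢᵢ), where 1/(A⁻¹)ᵢᵢ is Gamma distributed. With log(1 + x) ≤ xᵖ/p its mean is O(c⁻ᵖ Γ(n + 1
- p)/p) for K, and smaller shapes are never needed. If n ≥ 1, p = 1 gives O(1/ρ); if n = 0, p = 1 -
1/log c gives O(log ρ / ρ). -/

noncomputable section

open scoped ComplexOrder

/-! ### Unitary invariance of complex Gaussian vectors -/

/-- The law of a vector of `n` independent standard complex Gaussian variables. -/
def complexGaussianVector (n : ℕ) : Measure (Fin n → ℂ) :=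
  Measure.pi fun _ => stdComplexGaussian

instance instIsProbabilityMeasureComplexGaussianVector (n : ℕ) :
    IsProbabilityMeasure (complexGaussianVector n) := by
  unfold complexGaussianVector
  infer_instance

theorem rayleighLaw_eq_pi (m n : ℕ) :
    rayleighLaw m n = Measure.pi fun _ => complexGaussianVector n := rfl

theorem charFunDual_stdComplexGaussian (ℓ : StrongDual ℝ ℂ) (c : ℂ)
    (hℓ : ∀ z, ℓ z = (c * z).re) :
    charFunDual stdComplexGaussian ℓ = Complex.exp (-(Complex.normSq c : ℂ) / 4) := by
  have hm : Measurable (fun p : ℝ × ℝ => (⟨p.1, p.2⟩ : ℂ)) :=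
    Complex.measurableEquivRealProd.symm.measurable
  rw [charFunDual_apply, stdComplexGaussian, integral_map hm.aemeasurable
    (by fun_prop)]
  have h : ∀ p : ℝ × ℝ, Complex.exp ((ℓ (⟨p.1, p.2⟩ : ℂ) : ℂ) * Complex.I) =
      Complex.exp ((c.re : ℂ) * p.1 * Complex.I) *
        Complex.exp (((-c.im : ℝ) : ℂ) * p.2 * Complex.I) := by
    intro p
    rw [← Complex.exp_add, hℓ]
    congr 1
    simp
    ring
  simp_rw [h]
  rw [integral_prod_mul (fun x : ℝ => Complex.exp ((c.re : ℂ) * x * Complex.I))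
    (fun y : ℝ => Complex.exp (((-c.im : ℝ) : ℂ) * y * Complex.I)), ← charFun_apply_real,
    ← charFun_apply_real, charFun_gaussianReal, charFun_gaussianReal, ← Complex.exp_add]
  congr 1
  simp [Complex.normSq_apply]
  ring

theorem charFunDual_complexGaussianVector {n : ℕ} (ℓ : StrongDual ℝ (Fin n → ℂ)) (c : Fin n → ℂ)
    (hℓ : ∀ v, ℓ v = (v ⬝ᵥ c).re) :
    charFunDual (complexGaussianVector n) ℓ =
      Complex.exp (-((∑ i, Complex.normSq (c i) : ℝ) : ℂ) / 4) := by
  rw [complexGaussianVector, charFunDual_pi]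
  have h : ∀ i, charFunDual stdComplexGaussian
      (ℓ.comp (ContinuousLinearMap.single ℝ (fun _ : Fin n => ℂ) i)) =
      Complex.exp (-(Complex.normSq (c i) : ℂ) / 4) := by
    intro i
    apply charFunDual_stdComplexGaussian
    intro z
    simp [hℓ, mul_comm]
  simp_rw [h]
  rw [← Complex.exp_sum]
  congr 1
  simp [Finset.sum_neg_distrib, Finset.sum_div, neg_div]

theorem exists_dotProduct_re {n : ℕ} (ℓ : StrongDual ℝ (Fin n → ℂ)) :
    ∃ c : Fin n → ℂ, ∀ v, ℓ v = (v ⬝ᵥ c).re := by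
  refine ⟨fun i => ⟨ℓ (Pi.single i 1), -ℓ (Pi.single i Complex.I)⟩, fun v => ?_⟩
  have hv : v = ∑ i, ((v i).re • (Pi.single i 1 : Fin n → ℂ) +
      (v i).im • (Pi.single i Complex.I : Fin n → ℂ)) := by
    ext j
    simp only [Finset.sum_apply, Pi.add_apply, Pi.smul_apply, Pi.single_apply]
    rw [Finset.sum_eq_single j] <;> simp +contextual [eq_comm]
  conv_lhs => rw [hv]
  simp [dotProduct]

theorem sum_normSq_mulVec {n : ℕ} (U : Matrix (Fin n) (Fin n) ℂ) (hU : Uᴴ * U = 1)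
    (c : Fin n → ℂ) :
    ∑ i, Complex.normSq ((U *ᵥ c) i) = ∑ i, Complex.normSq (c i) := by
  have h : ∀ v : Fin n → ℂ, ((∑ i, Complex.normSq (v i) : ℝ) : ℂ) = star v ⬝ᵥ v := by
    intro v
    simp [dotProduct, Complex.normSq_eq_conj_mul_self]
  apply Complex.ofReal_injective
  rw [h, h, Matrix.star_mulVec, ← Matrix.dotProduct_mulVec, Matrix.mulVec_mulVec, hU,
    Matrix.one_mulVec]

/-- The characteristic function at v ↦ Re(v · c) depends on c only through its norm, and (vU) · c =
v · (Uc) with U an isometry. -/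
theorem measurePreserving_vecMul {n : ℕ} (U : Matrix (Fin n) (Fin n) ℂ) (hU : Uᴴ * U = 1) :
    MeasurePreserving (fun v : Fin n → ℂ => v ᵥ* U)
      (complexGaussianVector n) (complexGaussianVector n) := by
  let T : (Fin n → ℂ) →L[ℝ] (Fin n → ℂ) :=
    LinearMap.toContinuousLinearMap ((Matrix.vecMulLinear U).restrictScalars ℝ)
  have hT : ∀ v, T v = v ᵥ* U := fun v => rfl
  have hm : Measurable (fun v : Fin n → ℂ => v ᵥ* U) := T.continuous.measurable
  refine ⟨hm, ?_⟩
  change Measure.map T _ = _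
  have : IsProbabilityMeasure (Measure.map T (complexGaussianVector n)) :=
    Measure.isProbabilityMeasure_map T.continuous.measurable.aemeasurable
  apply Measure.ext_of_charFunDual
  ext ℓ
  obtain ⟨c, hc⟩ := exists_dotProduct_re ℓ
  rw [charFunDual_map, charFunDual_complexGaussianVector ℓ c hc,
    charFunDual_complexGaussianVector (ℓ.comp T) (U *ᵥ c), sum_normSq_mulVec U hU]
  intro v
  simp [hc, hT, Matrix.dotProduct_mulVec]

/-- The squared Euclidean norm of a complex vector. -/
def sqNorm {n : ℕ} (v : Fin n → ℂ) : ℝ := ∑ i, Complex.normSq (v i)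

theorem sqNorm_nonneg {n : ℕ} (v : Fin n → ℂ) : 0 ≤ sqNorm v :=
  Finset.sum_nonneg fun _ _ => Complex.normSq_nonneg _

@[fun_prop]
theorem measurable_sqNorm {n : ℕ} : Measurable (sqNorm (n := n)) := by
  unfold sqNorm
  have : Measurable Complex.normSq := Complex.continuous_normSq.measurable
  fun_prop

/-- Extend w/‖w‖ to an orthonormal basis b with b₀ = w/‖w‖ and take the conjugated basis vectors as
columns of U; then (wU)ⱼ = ⟨bⱼ, w⟩. -/
theorem exists_unitary_vecMul {n : ℕ} (w : Fin (n + 1) → ℂ) :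
    ∃ U : Matrix (Fin (n + 1)) (Fin (n + 1)) ℂ, Uᴴ * U = 1 ∧ U * Uᴴ = 1 ∧
      w ᵥ* U = Pi.single 0 (Real.sqrt (sqNorm w) : ℂ) := by
  by_cases hw : w = 0
  · exact ⟨1, by simp, by simp, by simp [hw, sqNorm]⟩
  let x : EuclideanSpace ℂ (Fin (n + 1)) := WithLp.toLp 2 w
  have hx : ‖x‖ = Real.sqrt (sqNorm w) := by
    simp [x, EuclideanSpace.norm_eq, sqNorm, Complex.normSq_eq_norm_sq]
  have hx0 : x ≠ 0 := by
    intro h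
    apply hw
    ext i
    have := congrArg (fun y : EuclideanSpace ℂ (Fin (n + 1)) => y i) h
    simpa [x] using this
  have hn : ‖x‖ ≠ 0 := norm_ne_zero_iff.mpr hx0
  have ho : Orthonormal ℂ (Set.domRestrict ({0} : Set (Fin (n + 1)))
      (fun _ => ((‖x‖⁻¹ : ℝ) : ℂ) • x)) := by
    rw [orthonormal_iff_ite]
    rintro ⟨i, hi⟩ ⟨j, hj⟩
    simp only [Set.mem_singleton_iff] at hi hj
    subst hi hj
    simp [Set.domRestrict, norm_smul, hn]
  obtain ⟨b, hb⟩ := ho.exists_orthonormalBasis_extension_of_card_eq (by simp)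
  have hb0 := hb 0 rfl
  have hxb : x = (‖x‖ : ℂ) • b 0 := by
    rw [hb0, smul_smul]
    simp [hn]
  have hUU : (Matrix.of fun i j => star (b j i))ᴴ * (Matrix.of fun i j => star (b j i)) = 1 := by
    ext i j
    have := orthonormal_iff_ite.mp b.orthonormal j i
    rw [PiLp.inner_apply] at this
    simp only [Matrix.mul_apply, Matrix.conjTranspose_apply, Matrix.of_apply, star_star,
      Matrix.one_apply]
    simp only [RCLike.inner_apply] at this
    simp only [eq_comm (a := i)]
    exact this
  refine ⟨_, hUU, mul_eq_one_comm.mp hUU, ?_⟩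
  ext j
  have := orthonormal_iff_ite.mp b.orthonormal j 0
  have h2 : inner ℂ (b j) x = (‖x‖ : ℂ) * if j = 0 then 1 else 0 := by
    conv_lhs => rw [hxb]
    rw [inner_smul_right, this]
  rw [PiLp.inner_apply] at h2
  simp only [RCLike.inner_apply] at h2
  simp only [Matrix.vecMul, dotProduct, Matrix.of_apply, ← hx, Pi.single_apply]
  simpa using h2

/-! ### Symmetries of the Gaussian matrix law -/

/-- In a Gaussian matrix the first row may be rotated onto the first coordinate axis. -/
theorem lintegral_rayleighLaw_succ {m n : ℕ} (G : Matrix (Fin (m + 1)) (Fin (m + 1)) ℂ → ENNReal)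
    (hG : Measurable fun H : Fin (m + 1) → Fin (n + 1) → ℂ => G (Matrix.of H * (Matrix.of H)ᴴ)) :
    ∫⁻ H, G (Matrix.of H * (Matrix.of H)ᴴ) ∂(rayleighLaw (m + 1) (n + 1)) =
      ∫⁻ w, ∫⁻ H : Fin m → Fin (n + 1) → ℂ,
        G (Matrix.of (Fin.cons (Pi.single 0 (Real.sqrt (sqNorm w) : ℂ)) H :
            Fin (m + 1) → Fin (n + 1) → ℂ) *
          (Matrix.of (Fin.cons (Pi.single 0 (Real.sqrt (sqNorm w) : ℂ)) H :
            Fin (m + 1) → Fin (n + 1) → ℂ))ᴴ)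
        ∂(rayleighLaw m (n + 1)) ∂(complexGaussianVector (n + 1)) := by
  have hp := (measurePreserving_piFinSuccAbove
    (fun _ : Fin (m + 1) => complexGaussianVector (n + 1)) 0).symm
  rw [rayleighLaw_eq_pi, ← hp.lintegral_comp hG]
  refine (lintegral_prod _ (hG.comp hp.measurable).aemeasurable).trans ?_
  refine lintegral_congr fun w => ?_
  obtain ⟨U, hU, hU', hw⟩ := exists_unitary_vecMul w
  -- U depends on w, but for each fixed w the law of the other rows is U-invariant, and UU† = 1
  -- makes the Gram matrix blind to the rotation.
  have hpres : MeasurePreserving (fun (H : Fin m → Fin (n + 1) → ℂ) i => H i ᵥ* U)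
      (rayleighLaw m (n + 1)) (rayleighLaw m (n + 1)) :=
    measurePreserving_pi _ _ fun _ => measurePreserving_vecMul U hU
  have hcons : Measurable fun H : Fin m → Fin (n + 1) → ℂ =>
      (Fin.cons (Pi.single 0 (Real.sqrt (sqNorm w) : ℂ)) H : Fin (m + 1) → Fin (n + 1) → ℂ) := by
    refine measurable_pi_lambda _ fun i => ?_
    refine Fin.cases ?_ (fun i => ?_) i
    · simp
    · simpa using measurable_pi_apply i
  refine Eq.trans ?_ (hpres.lintegral_comp (hG.comp hcons))
  refine lintegral_congr fun H => ?_
  simp only [Function.comp_apply]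
  congr 1
  have key : (Matrix.of (Fin.cons (Pi.single 0 (Real.sqrt (sqNorm w) : ℂ))
      (fun i => H i ᵥ* U) : Fin (m + 1) → Fin (n + 1) → ℂ)) =
      Matrix.of (Fin.cons w H : Fin (m + 1) → Fin (n + 1) → ℂ) * U := by
    ext i j
    refine Fin.cases ?_ (fun i => ?_) i
    · simp only [Matrix.of_apply, Fin.cons_zero, ← hw]
      rfl
    · rfl
  have hsymm : (MeasurableEquiv.piFinSuccAbove (fun _ : Fin (m + 1) => Fin (n + 1) → ℂ) 0).symm
      (w, H) = Fin.cons w H := by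
    simp [MeasurableEquiv.piFinSuccAbove, Fin.consEquiv]
  erw [hsymm]
  rw [key, Matrix.conjTranspose_mul, Matrix.mul_assoc, ← Matrix.mul_assoc U, hU', Matrix.one_mul]
  rfl

/-- Removing a column of a Gaussian matrix yields a Gaussian matrix. -/
theorem measurePreserving_removeCol (m n : ℕ) (k : Fin (n + 1)) :
    MeasurePreserving (fun (H : Fin m → Fin (n + 1) → ℂ) i j => H i (k.succAbove j))
      (rayleighLaw m (n + 1)) (rayleighLaw m n) := by
  have hrow : MeasurePreserving (fun (v : Fin (n + 1) → ℂ) j => v (k.succAbove j))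
      (complexGaussianVector (n + 1)) (complexGaussianVector n) := ?_
  · exact measurePreserving_pi (fun _ : Fin m => complexGaussianVector (n + 1))
      (fun _ => complexGaussianVector n) fun _ => hrow
  have h := (measurePreserving_piFinSuccAbove (fun _ : Fin (n + 1) => stdComplexGaussian) k)
  exact measurePreserving_snd.comp h

/-- Permuting the rows of a Gaussian matrix preserves its law. -/
theorem measurePreserving_permRows (m n : ℕ) (σ : Equiv.Perm (Fin m)) :
    MeasurePreserving (fun (H : Fin m → Fin n → ℂ) i => H (σ i))
      (rayleighLaw m n) (rayleighLaw m n) := by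
  have := measurePreserving_piCongrLeft (fun _ : Fin m => complexGaussianVector n) σ.symm
  change MeasurePreserving _ (rayleighLaw m n) (rayleighLaw m n) at this
  convert this using 1
  ext H i : 2
  have h := Equiv.piCongrLeft_apply_apply (P := fun _ => Fin n → ℂ) σ.symm H (σ i)
  rw [Equiv.symm_apply_apply] at h
  exact h.symm

/-! ### Squared norms and Gamma laws -/

/-- The density e^(-|z|²)/π is radial: polar coordinates integrate the angle out, and s = r² turns
2r dr into ds, leaving an exponential law. -/
theorem lintegral_normSq_stdComplexGaussian (f : ℝ → ENNReal) (hf : Measurable f) :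
    ∫⁻ z, f (Complex.normSq z) ∂stdComplexGaussian =
      ∫⁻ s in Set.Ioi (0 : ℝ), f s * ENNReal.ofReal (Real.exp (-s)) := by
  have hm : Measurable (fun p : ℝ × ℝ => (⟨p.1, p.2⟩ : ℂ)) :=
    Complex.measurableEquivRealProd.symm.measurable
  have hn : Measurable Complex.normSq := Complex.continuous_normSq.measurable
  have hv : (1 / 2 : NNReal) ≠ 0 := by norm_num
  have hg : gaussianPDF 0 (1 / 2) =
      fun x => ENNReal.ofReal (Real.exp (-x ^ 2) / Real.sqrt Real.pi) := by
    ext x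
    rw [gaussianPDF, gaussianPDFReal]
    congr 1
    push_cast
    field_simp
    simp
  have hgm : Measurable fun x : ℝ => ENNReal.ofReal (Real.exp (-x ^ 2) / Real.sqrt Real.pi) := by
    fun_prop
  rw [stdComplexGaussian, lintegral_map (f := fun z => f (Complex.normSq z)) (hf.comp hn) hm,
    gaussianReal_of_var_ne_zero _ hv, hg,
    prod_withDensity hgm hgm, lintegral_withDensity_eq_lintegral_mul _ (by fun_prop)
      (g := fun p : ℝ × ℝ => f (Complex.normSq (⟨p.1, p.2⟩ : ℂ))) ((hf.comp hn).comp hm),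
    ← Measure.volume_eq_prod, ← lintegral_comp_polarCoord_symm]
  have h1 : ∀ p ∈ polarCoord.target, ENNReal.ofReal p.1 •
      ((fun z : ℝ × ℝ => ENNReal.ofReal (Real.exp (-z.1 ^ 2) / Real.sqrt Real.pi) *
        ENNReal.ofReal (Real.exp (-z.2 ^ 2) / Real.sqrt Real.pi)) *
        fun p : ℝ × ℝ => f (Complex.normSq (⟨p.1, p.2⟩ : ℂ))) (polarCoord.symm p) =
      (ENNReal.ofReal (2 * p.1) * (f (p.1 ^ 2) * ENNReal.ofReal (Real.exp (-p.1 ^ 2)))) *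
        ENNReal.ofReal (1 / (2 * Real.pi)) := by
    intro p hp
    have hp1 : 0 < p.1 := hp.1
    have e1 : Complex.normSq ⟨p.1 * Real.cos p.2, p.1 * Real.sin p.2⟩ = p.1 ^ 2 := by
      rw [Complex.normSq_mk]
      linear_combination p.1 ^ 2 * Real.sin_sq_add_cos_sq p.2
    have e2 : Real.exp (-(p.1 * Real.cos p.2) ^ 2) / Real.sqrt Real.pi *
        (Real.exp (-(p.1 * Real.sin p.2) ^ 2) / Real.sqrt Real.pi) =
        Real.exp (-p.1 ^ 2) / Real.pi := by
      rw [div_mul_div_comm, ← Real.exp_add, Real.mul_self_sqrt Real.pi_pos.le]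
      congr 2
      linear_combination -p.1 ^ 2 * Real.sin_sq_add_cos_sq p.2
    simp only [polarCoord_symm_apply, Pi.mul_apply, smul_eq_mul]
    have e3 : ENNReal.ofReal p.1 * ENNReal.ofReal (Real.exp (-p.1 ^ 2) / Real.pi) =
        ENNReal.ofReal (2 * p.1) * ENNReal.ofReal (Real.exp (-p.1 ^ 2)) *
          ENNReal.ofReal (1 / (2 * Real.pi)) := by
      rw [← ENNReal.ofReal_mul (by positivity), ← ENNReal.ofReal_mul (by positivity),
        ← ENNReal.ofReal_mul (by positivity)]
      congr 1
      field_simp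
    rw [e1, ← ENNReal.ofReal_mul (by positivity), e2, ← mul_assoc, e3]
    ring
  rw [setLIntegral_congr_fun polarCoord.open_target.measurableSet h1, polarCoord_target,
    Measure.volume_eq_prod, setLIntegral_prod _ (by fun_prop)]
  simp only [lintegral_const, MeasurableSet.univ, Measure.restrict_apply, Set.univ_inter,
    Real.volume_Ioo]
  have h2 : ENNReal.ofReal (1 / (2 * Real.pi)) * ENNReal.ofReal (Real.pi - -Real.pi) = 1 := by
    rw [← ENNReal.ofReal_mul (by positivity), ← ENNReal.ofReal_one]
    congr 1
    field_simp
    ring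
  simp only [mul_assoc, h2, mul_one]
  have himg : (fun r : ℝ => r ^ 2) '' Set.Ioi 0 = Set.Ioi 0 := by
    ext y
    constructor
    · rintro ⟨r, hr, rfl⟩
      exact pow_pos (show (0 : ℝ) < r from hr) 2
    · intro hy
      exact ⟨Real.sqrt y, Real.sqrt_pos.mpr hy, Real.sq_sqrt (le_of_lt hy)⟩
  have hinj : Set.InjOn (fun r : ℝ => r ^ 2) (Set.Ioi 0) := by
    intro a ha b hb hab
    exact (pow_left_inj₀ (le_of_lt ha) (le_of_lt hb) two_ne_zero).mp hab
  conv_rhs => rw [← himg, lintegral_image_eq_lintegral_abs_deriv_mul measurableSet_Ioi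
    (f' := fun r => 2 * r) (fun r _ => by simpa using (hasDerivAt_pow 2 r).hasDerivWithinAt) hinj]
  refine setLIntegral_congr_fun measurableSet_Ioi fun r hr => ?_
  rw [abs_of_pos (mul_pos two_pos hr)]

/-- The Gamma law with integer shape `n + 1` and rate `1`. -/
def gammaLaw (n : ℕ) : Measure ℝ :=
  (volume.restrict (Set.Ioi 0)).withDensity fun s =>
    ENNReal.ofReal (s ^ n * Real.exp (-s) / n.factorial)

theorem lintegral_gammaLaw (n : ℕ) (f : ℝ → ENNReal) (hf : Measurable f) :
    ∫⁻ s, f s ∂gammaLaw n =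
      ∫⁻ s in Set.Ioi 0, f s * ENNReal.ofReal (s ^ n * Real.exp (-s) / n.factorial) := by
  rw [gammaLaw, lintegral_withDensity_eq_lintegral_mul _ (by fun_prop) hf]
  simp [mul_comm]

/-- Adding an independent exponential raises the shape by one: with u = t + s the exponentials merge
into e^(-u), and ∫ sⁿ over (0, u) is uⁿ⁺¹/(n + 1). -/
theorem lintegral_gammaLaw_conv (n : ℕ) (f : ℝ → ENNReal) (hf : Measurable f) :
    ∫⁻ t in Set.Ioi (0 : ℝ), (∫⁻ s, f (t + s) ∂gammaLaw n) * ENNReal.ofReal (Real.exp (-t)) =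
      ∫⁻ s, f s ∂gammaLaw (n + 1) := by
  set p : ℝ → ENNReal := fun s => ENNReal.ofReal (s ^ n * Real.exp (-s) / n.factorial) with hp
  have hpm : Measurable p := by fun_prop
  have h1 : ∀ t ∈ Set.Ioi (0 : ℝ),
      (∫⁻ s, f (t + s) ∂gammaLaw n) * ENNReal.ofReal (Real.exp (-t)) =
      ∫⁻ s in Set.Ioi 0, f (t + s) * p s * ENNReal.ofReal (Real.exp (-t)) := by
    intro t _
    rw [lintegral_gammaLaw n _ (by fun_prop), lintegral_mul_const _ (by fun_prop)]
  rw [setLIntegral_congr_fun measurableSet_Ioi h1, lintegral_lintegral_swap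
    (by unfold Function.uncurry; fun_prop)]
  have h2 : ∀ s ∈ Set.Ioi (0 : ℝ),
      ∫⁻ t in Set.Ioi 0, f (t + s) * p s * ENNReal.ofReal (Real.exp (-t)) =
      ∫⁻ u in Set.Ioi 0, (Set.Ioi s).indicator
        (fun u => f u * p s * ENNReal.ofReal (Real.exp (-(u - s)))) u := by
    intro s hs
    rw [setLIntegral_indicator measurableSet_Ioi, Set.inter_eq_left.mpr
      (Set.Ioi_subset_Ioi (le_of_lt hs)), ← lintegral_indicator measurableSet_Ioi,
      ← lintegral_indicator measurableSet_Ioi, ← lintegral_sub_right_eq_self _ s]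
    refine lintegral_congr fun t => ?_
    simp [Set.indicator]
  rw [setLIntegral_congr_fun measurableSet_Ioi h2, lintegral_lintegral_swap,
    lintegral_gammaLaw _ _ hf]
  · refine setLIntegral_congr_fun measurableSet_Ioi fun u hu => ?_
    have hu0 : (0 : ℝ) < u := hu
    have h3 : ∀ s ∈ Set.Ioi (0 : ℝ), (Set.Ioi s).indicator
        (fun u => f u * p s * ENNReal.ofReal (Real.exp (-(u - s)))) u =
        (Set.Iio u).indicator (fun s => f u * (ENNReal.ofReal (s ^ n) *
          ENNReal.ofReal (Real.exp (-u) / n.factorial))) s := by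
      intro s hs
      have hs0 : (0 : ℝ) < s := hs
      by_cases hsu : s < u
      · rw [Set.indicator_of_mem (show u ∈ Set.Ioi s from hsu),
          Set.indicator_of_mem (show s ∈ Set.Iio u from hsu), hp, mul_assoc,
          ← ENNReal.ofReal_mul (by positivity), ← ENNReal.ofReal_mul (by positivity)]
        congr 2
        have : Real.exp (-u) = Real.exp (-s) * Real.exp (-(u - s)) := by
          rw [← Real.exp_add]; ring_nf
        rw [this]
        ring
      · rw [Set.indicator_of_notMem (show u ∉ Set.Ioi s from hsu),
          Set.indicator_of_notMem (show s ∉ Set.Iio u from hsu)]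
    rw [setLIntegral_congr_fun measurableSet_Ioi h3, setLIntegral_indicator measurableSet_Iio,
      lintegral_const_mul _ (by fun_prop), lintegral_mul_const _ (by fun_prop)]
    congr 1
    have h4 : ∫⁻ s in Set.Iio u ∩ Set.Ioi 0, ENNReal.ofReal (s ^ n) =
        ENNReal.ofReal (u ^ (n + 1) / (n + 1)) := by
      rw [Set.inter_comm, Set.Ioi_inter_Iio, restrict_Ioo_eq_restrict_Ioc,
        ← ofReal_integral_eq_lintegral_ofReal, ← intervalIntegral.integral_of_le hu0.le,
        integral_pow]
      · simp
      · exact (intervalIntegral.intervalIntegrable_pow n).1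
      · exact (ae_restrict_mem measurableSet_Ioc).mono fun s hs => pow_nonneg hs.1.le n
    rw [h4, ← ENNReal.ofReal_mul (by positivity), Nat.factorial_succ]
    congr 1
    push_cast
    field_simp
  · refine Measurable.aemeasurable ?_
    have hset : MeasurableSet {q : ℝ × ℝ | q.1 < q.2} := measurableSet_lt measurable_fst measurable_snd
    have : (Function.uncurry fun s u : ℝ => (Set.Ioi s).indicator
        (fun u => f u * p s * ENNReal.ofReal (Real.exp (-(u - s)))) u) =
        {q : ℝ × ℝ | q.1 < q.2}.indicator
          fun q => f q.2 * p q.1 * ENNReal.ofReal (Real.exp (-(q.2 - q.1))) := by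
      ext q
      simp [Function.uncurry, Set.indicator]
    rw [this]
    exact Measurable.indicator (by fun_prop) hset

theorem lintegral_sqNorm (n : ℕ) (f : ℝ → ENNReal) (hf : Measurable f) :
    ∫⁻ w, f (sqNorm w) ∂complexGaussianVector (n + 1) = ∫⁻ s, f s ∂gammaLaw n := by
  have hn : Measurable Complex.normSq := Complex.continuous_normSq.measurable
  induction n generalizing f with
  | zero =>
    have := (measurePreserving_eval (fun _ : Fin 1 => stdComplexGaussian) 0).lintegral_comp
      (hf.comp hn)
    rw [lintegral_gammaLaw _ _ hf]
    simp only [pow_zero, Nat.factorial_zero, Nat.cast_one, one_mul, div_one]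
    rw [← lintegral_normSq_stdComplexGaussian f hf]
    refine Eq.trans ?_ this
    simp [complexGaussianVector, sqNorm]
  | succ n ih =>
    have hp := (measurePreserving_piFinSuccAbove
      (fun _ : Fin (n + 2) => stdComplexGaussian) 0).symm
    refine (hp.lintegral_comp (hf.comp measurable_sqNorm)).symm.trans ?_
    refine (lintegral_prod _ ((hf.comp measurable_sqNorm).comp hp.measurable).aemeasurable).trans ?_
    have h1 : ∀ z : ℂ, ∫⁻ w : Fin (n + 1) → ℂ, ((fun v => f (sqNorm v)) ∘
        (MeasurableEquiv.piFinSuccAbove (fun _ : Fin (n + 2) => ℂ) 0).symm) (z, w)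
          ∂(Measure.pi fun _ => stdComplexGaussian) =
        ∫⁻ s, f (Complex.normSq z + s) ∂gammaLaw n := by
      intro z
      rw [← ih (fun s => f (Complex.normSq z + s)) (by fun_prop)]
      refine lintegral_congr fun w => ?_
      simp [MeasurableEquiv.piFinSuccAbove, sqNorm, Fin.sum_univ_succ, Fin.consEquiv]
    refine (lintegral_congr h1).trans ?_
    have : SFinite (gammaLaw n) := by unfold gammaLaw; infer_instance
    rw [lintegral_normSq_stdComplexGaussian (fun t => ∫⁻ s, f (t + s) ∂gammaLaw n)
      (Measurable.lintegral_prod_right (by fun_prop)), lintegral_gammaLaw_conv n f hf]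

theorem map_sqNorm (n : ℕ) : (complexGaussianVector (n + 1)).map sqNorm = gammaLaw n := by
  refine Measure.ext_of_lintegral _ fun f hf => ?_
  rw [lintegral_map hf measurable_sqNorm, lintegral_sqNorm n f hf]

/-- Total mass one is inherited from the Gaussian vector whose squared norm has this law. -/
instance instIsProbabilityMeasureGammaLaw (n : ℕ) : IsProbabilityMeasure (gammaLaw n) := by
  rw [← map_sqNorm]
  exact Measure.isProbabilityMeasure_map measurable_sqNorm.aemeasurable

theorem gammaLaw_ae_pos (n : ℕ) : ∀ᵐ s ∂gammaLaw n, 0 < s :=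
  (withDensity_absolutelyContinuous _ _).ae_le (ae_restrict_mem measurableSet_Ioi)

theorem sqNorm_ae_pos (n : ℕ) : ∀ᵐ w ∂complexGaussianVector (n + 1), 0 < sqNorm w := by
  have := gammaLaw_ae_pos n
  rw [← map_sqNorm] at this
  exact ae_of_ae_map measurable_sqNorm.aemeasurable this

theorem integrable_gammaLaw_iff (n : ℕ) (g : ℝ → ℝ) :
    Integrable g (gammaLaw n) ↔
      IntegrableOn (fun s => s ^ n * Real.exp (-s) / n.factorial * g s) (Set.Ioi 0) := by
  rw [gammaLaw, integrable_withDensity_iff_integrable_smul' (by fun_prop) (by simp)]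
  refine integrableOn_congr_fun (fun s hs => ?_) measurableSet_Ioi
  have : (0 : ℝ) < s := hs
  rw [ENNReal.toReal_ofReal (by positivity), smul_eq_mul]

theorem integral_gammaLaw (n : ℕ) (g : ℝ → ℝ) :
    ∫ s, g s ∂gammaLaw n =
      ∫ s in Set.Ioi 0, s ^ n * Real.exp (-s) / n.factorial * g s := by
  rw [gammaLaw, integral_withDensity_eq_integral_toReal_smul (by fun_prop) (by simp)]
  refine setIntegral_congr_fun measurableSet_Ioi fun s hs => ?_
  have : (0 : ℝ) < s := hs
  rw [ENNReal.toReal_ofReal (by positivity), smul_eq_mul]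

/-! ### Logarithmic moments of Gamma laws -/

/-- The power -1/2 is integrable at 0 even against the shape-one density. -/
theorem abs_log_le (s : ℝ) (hs : 0 < s) : |Real.log s| ≤ s + 2 * s ^ (-(1 / 2) : ℝ) := by
  have h1 := Real.log_le_self hs.le
  have h2 : -Real.log s ≤ 2 * s ^ (-(1 / 2) : ℝ) := by
    have h := Real.log_le_self (Real.rpow_nonneg hs.le (-(1 / 2) : ℝ))
    rw [Real.log_rpow hs] at h
    linarith
  have h3 := Real.rpow_nonneg hs.le (-(1 / 2) : ℝ)
  rw [abs_le]
  constructor <;> linarith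

theorem integrableOn_pow_mul_exp_mul_log (n : ℕ) :
    IntegrableOn (fun s => s ^ n * Real.exp (-s) * Real.log s) (Set.Ioi 0) := by
  have h1 := Real.GammaIntegral_convergent (s := n + 2) (by positivity)
  have h2 := Real.GammaIntegral_convergent (s := n + 1 / 2) (by positivity)
  refine Integrable.mono' (h1.add (h2.const_mul 2)) (by fun_prop) ?_
  refine (ae_restrict_mem measurableSet_Ioi).mono fun s hs => ?_
  have hs0 : (0 : ℝ) < s := hs
  rw [Real.norm_eq_abs, abs_mul, abs_of_pos (by positivity)]
  refine (mul_le_mul_of_nonneg_left (abs_log_le s hs0) (by positivity)).trans (le_of_eq ?_)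
  have e1 : s ^ ((n : ℝ) + 2 - 1) = s ^ n * s := by
    rw [show (n : ℝ) + 2 - 1 = n + 1 by ring, Real.rpow_add_one hs0.ne', Real.rpow_natCast]
  have e2 : s ^ ((n : ℝ) + 1 / 2 - 1) = s ^ n * s ^ (-(1 / 2) : ℝ) := by
    rw [show (n : ℝ) + 1 / 2 - 1 = n + (-(1 / 2)) by ring, Real.rpow_add hs0, Real.rpow_natCast]
  simp only [Pi.add_apply, e1, e2]
  ring

theorem integrable_log_gammaLaw (n : ℕ) : Integrable Real.log (gammaLaw n) := by
  rw [integrable_gammaLaw_iff]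
  refine ((integrableOn_pow_mul_exp_mul_log n).div_const (n.factorial : ℝ)).congr ?_
  exact ae_of_all _ fun s => by ring

theorem integral_pow_mul_exp (n : ℕ) :
    ∫ s in Set.Ioi (0 : ℝ), s ^ n * Real.exp (-s) = n.factorial := by
  rw [← Real.Gamma_nat_eq_factorial, Real.Gamma_eq_integral (by positivity)]
  refine setIntegral_congr_fun measurableSet_Ioi fun s _ => ?_
  simp [mul_comm]

theorem integrableOn_pow_mul_exp (n : ℕ) :
    IntegrableOn (fun s => s ^ n * Real.exp (-s)) (Set.Ioi 0) := by
  have h1 := Real.GammaIntegral_convergent (s := n + 1) (by positivity)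
  refine h1.congr_fun (fun s _ => ?_) measurableSet_Ioi
  simp [mul_comm]

/-- Integrate the derivative of (s log s) sⁿ e^(-s) over the half-line; both boundary values vanish.
Grouping s with log s gives continuity at 0 also when n = 0. -/
theorem integral_log_gammaLaw_succ (n : ℕ) :
    ∫ s, Real.log s ∂gammaLaw (n + 1) = ∫ s, Real.log s ∂gammaLaw n + 1 / (n + 1) := by
  have hA := integrableOn_pow_mul_exp n
  have hB := integrableOn_pow_mul_exp_mul_log n
  have hC := integrableOn_pow_mul_exp_mul_log (n + 1)
  have hint : IntegrableOn (fun s => s ^ n * Real.exp (-s) +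
      (n + 1) * (s ^ n * Real.exp (-s) * Real.log s) -
      s ^ (n + 1) * Real.exp (-s) * Real.log s) (Set.Ioi 0) :=
    (hA.add (hB.const_mul ((n : ℝ) + 1))).sub hC
  have hderiv : ∀ s ∈ Set.Ioi (0 : ℝ), HasDerivAt
      (fun s => (s * Real.log s) * (s ^ n * Real.exp (-s)))
      (s ^ n * Real.exp (-s) + (n + 1) * (s ^ n * Real.exp (-s) * Real.log s) -
      s ^ (n + 1) * Real.exp (-s) * Real.log s) s := by
    intro s hs
    have hs0 : s ≠ 0 := ne_of_gt hs
    have h := (Real.hasDerivAt_mul_log hs0).mul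
      ((hasDerivAt_pow n s).mul ((hasDerivAt_neg s).exp))
    refine h.congr_deriv ?_
    -- The derivative of sⁿ carries the truncated exponent n - 1, hence the case split.
    rcases n with _ | n
    · simp; ring
    · simp only [Nat.add_sub_cancel]; push_cast; simp only [Pi.mul_apply]; ring
  have hlim : Tendsto (fun s => (s * Real.log s) * (s ^ n * Real.exp (-s))) atTop (𝓝 0) := by
    have h0 := Real.tendsto_pow_mul_exp_neg_atTop_nhds_zero (n + 2)
    refine squeeze_zero' ?_ ?_ h0
    · filter_upwards [eventually_ge_atTop 1] with s hs
      have := Real.log_nonneg hs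
      have : (0 : ℝ) ≤ s := by linarith
      positivity
    · filter_upwards [eventually_ge_atTop 1] with s hs
      have hs0 : (0 : ℝ) ≤ s := by linarith
      have := Real.log_le_self hs0
      calc (s * Real.log s) * (s ^ n * Real.exp (-s)) ≤ (s * s) * (s ^ n * Real.exp (-s)) := by
            gcongr
        _ = _ := by ring
  have hcont : ContinuousWithinAt (fun s => (s * Real.log s) * (s ^ n * Real.exp (-s)))
      (Set.Ici 0) 0 := by
    have : Continuous (fun s => (s * Real.log s) * (s ^ n * Real.exp (-s))) :=
      Real.continuous_mul_log.mul (by fun_prop)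
    exact this.continuousWithinAt
  have h := integral_Ioi_of_hasDerivAt_of_tendsto hcont hderiv hint hlim
  have hAB : IntegrableOn (fun s => s ^ n * Real.exp (-s) +
      (n + 1) * (s ^ n * Real.exp (-s) * Real.log s)) (Set.Ioi 0) :=
    hA.add (hB.const_mul ((n : ℝ) + 1))
  rw [integral_sub hAB hC, integral_add hA (hB.const_mul ((n : ℝ) + 1)), integral_const_mul,
    integral_pow_mul_exp] at h
  have e : ∀ k : ℕ, ∫ s, Real.log s ∂gammaLaw k =
      (∫ s in Set.Ioi 0, s ^ k * Real.exp (-s) * Real.log s) / k.factorial := by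
    intro k
    rw [integral_gammaLaw, ← integral_div]
    congr 1
    ext s
    ring
  rw [e, e, Nat.factorial_succ]
  have hf : (n.factorial : ℝ) ≠ 0 := by positivity
  push_cast
  field_simp
  simp at h
  linarith

/-- Subadditivity (1 + x)ᵖ ≤ 1 + xᵖ combined with log y ≤ y - 1 at y = (1 + x)ᵖ. -/
theorem log_one_add_le_rpow (x p : ℝ) (hx : 0 ≤ x) (hp : 0 < p) (hp1 : p ≤ 1) :
    Real.log (1 + x) ≤ x ^ p / p := by
  rw [le_div_iff₀ hp, mul_comm, ← Real.log_rpow (by linarith)]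
  have h1 : (1 + x) ^ p ≤ 1 + x ^ p := by
    simpa using Real.rpow_add_le_add_rpow zero_le_one hx hp.le hp1
  calc Real.log ((1 + x) ^ p) ≤ (1 + x) ^ p - 1 := Real.log_le_sub_one_of_pos (by positivity)
    _ ≤ _ := by linarith

/-- The exponent p stays free: larger p means faster decay in ε, while p < n + 1 keeps s^(n - p)
integrable at 0. -/
theorem lintegral_log_one_add_div_gammaLaw_le (n : ℕ) (ε p : ℝ) (hε : 0 < ε) (hp : 0 < p)
    (hp1 : p ≤ 1) (hpn : p < n + 1) :
    ∫⁻ s, ENNReal.ofReal (Real.log (1 + ε * s⁻¹)) ∂gammaLaw n ≤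
      ENNReal.ofReal (ε ^ p * Real.Gamma (n + 1 - p) / p) := by
  have hI := Real.GammaIntegral_convergent (s := n + 1 - p) (by linarith)
  rw [lintegral_gammaLaw n _ (by fun_prop)]
  have hnn : 0 ≤ᵐ[volume.restrict (Set.Ioi 0)] fun s : ℝ =>
      ε ^ p / p * (Real.exp (-s) * s ^ ((n : ℝ) + 1 - p - 1)) := by
    refine (ae_restrict_mem measurableSet_Ioi).mono fun s hs => ?_
    have hs0 : (0 : ℝ) < s := hs
    exact mul_nonneg (by positivity) (by positivity)
  calc _ ≤ ∫⁻ s in Set.Ioi 0, ENNReal.ofReal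
        (ε ^ p / p * (Real.exp (-s) * s ^ ((n : ℝ) + 1 - p - 1))) := by
        refine setLIntegral_mono (by fun_prop) fun s hs => ?_
        have hs0 : (0 : ℝ) < s := hs
        have hx : 0 ≤ ε * s⁻¹ := by positivity
        have hl := log_one_add_le_rpow (ε * s⁻¹) p hx hp hp1
        rw [← ENNReal.ofReal_mul (Real.log_nonneg (by linarith))]
        refine ENNReal.ofReal_le_ofReal ?_
        have hfac : (1 : ℝ) ≤ n.factorial := by
          exact_mod_cast Nat.one_le_iff_ne_zero.mpr n.factorial_ne_zero
        calc Real.log (1 + ε * s⁻¹) * (s ^ n * Real.exp (-s) / n.factorial)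
            ≤ ((ε * s⁻¹) ^ p / p) * (s ^ n * Real.exp (-s)) := by
              refine mul_le_mul hl (div_le_self (by positivity) hfac) (by positivity)
                (by positivity)
          _ = _ := by
              rw [Real.mul_rpow hε.le (by positivity), Real.inv_rpow hs0.le,
                show (n : ℝ) + 1 - p - 1 = n - p by ring, Real.rpow_sub hs0, Real.rpow_natCast]
              field_simp
    _ = _ := by
        rw [← ofReal_integral_eq_lintegral_ofReal (hI.const_mul _) hnn, integral_const_mul,
          ← Real.Gamma_eq_integral (by linarith)]
        congr 1
        ring

/-! ### Determinant identities -/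

/-- The first row is r e₀, so subtracting multiples of the Gram matrix's first row clears the rest
of its first column and exactly removes the rank-one contribution of column 0 of H. -/
theorem det_gram_cons {m n : ℕ} (r : ℂ) (H : Fin m → Fin (n + 1) → ℂ) :
    (Matrix.of (Fin.cons (Pi.single 0 r) H : Fin (m + 1) → Fin (n + 1) → ℂ) *
      (Matrix.of (Fin.cons (Pi.single 0 r) H : Fin (m + 1) → Fin (n + 1) → ℂ))ᴴ).det =
    Complex.normSq r *
      ((Matrix.of fun i j => H i (Fin.succ j) : Matrix (Fin m) (Fin n) ℂ) *
        (Matrix.of fun i j => H i (Fin.succ j) : Matrix (Fin m) (Fin n) ℂ)ᴴ).det := by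
  set L := Matrix.of (Fin.cons (Pi.single 0 r) H : Fin (m + 1) → Fin (n + 1) → ℂ) with hL
  set A := (Matrix.of fun i j => H i (Fin.succ j) : Matrix (Fin m) (Fin n) ℂ) *
        (Matrix.of fun i j => H i (Fin.succ j) : Matrix (Fin m) (Fin n) ℂ)ᴴ with hA
  have e00 : (L * Lᴴ) 0 0 = Complex.normSq r := by
    simp [hL, Matrix.mul_apply, Pi.single_apply, Complex.mul_conj]
  have e0s : ∀ j : Fin m, (L * Lᴴ) 0 j.succ = r * star (H j 0) := by
    intro j
    simp [hL, Matrix.mul_apply, Pi.single_apply]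
  have es0 : ∀ i : Fin m, (L * Lᴴ) i.succ 0 = H i 0 * star r := by
    intro i
    simp [hL, Matrix.mul_apply, Pi.single_apply, apply_ite]
  have ess : ∀ i j : Fin m, (L * Lᴴ) i.succ j.succ = A i j + H i 0 * star (H j 0) := by
    intro i j
    simp [hL, hA, Matrix.mul_apply, Fin.sum_univ_succ, add_comm]
  by_cases hr : r = 0
  · rw [Matrix.det_eq_zero_of_row_eq_zero 0]
    · simp [hr]
    · intro j
      refine Fin.cases ?_ (fun j => ?_) j
      · simp [e00, hr]
      · rw [e0s, hr, zero_mul]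
  let B : Matrix (Fin (m + 1)) (Fin (m + 1)) ℂ :=
    Matrix.of (Fin.cons ((L * Lᴴ) 0) fun i => Fin.cons 0 (A i))
  have hB : (L * Lᴴ).det = B.det := by
    apply Matrix.det_eq_of_forall_row_eq_smul_add_const
      (Fin.cons 0 fun i => H i 0 / r : Fin (m + 1) → ℂ) 0 (by simp)
    intro i j
    refine Fin.cases ?_ (fun i => ?_) i
    · simp [B]
    · refine Fin.cases ?_ (fun j => ?_) j
      · simp [B, es0, e00, ← Complex.mul_conj]
        field_simp
      · simp [B, ess, e0s]
        field_simp
  rw [hB, Matrix.det_succ_column_zero, Fin.sum_univ_succ]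
  have hsub : B.submatrix (Fin.succAbove 0) Fin.succ = A := by
    ext i j
    simp [B]
  have hz : ∀ i : Fin m, B i.succ 0 = 0 := fun i => by simp [B]
  have h0 : B 0 0 = Complex.normSq r := e00
  simp only [hsub, hz, h0]
  simp

/-- For a positive semidefinite matrix, `0 ≤ log det (1 + P) ≤ m log (1 + tr P)`. -/
theorem log_det_one_add {m : ℕ} (P : Matrix (Fin m) (Fin m) ℂ) (hP : P.PosSemidef) :
    1 ≤ (1 + P).det.re ∧ (1 + P).det = ((1 + P).det.re : ℂ) ∧ 0 ≤ P.trace.re ∧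
      Real.log (1 + P).det.re ≤ m * Real.log (1 + P.trace.re) := by
  have hl := hP.eigenvalues_nonneg
  set l := hP.isHermitian.eigenvalues
  have hdet : (1 + P).det = ((∏ i, (1 + l i) : ℝ) : ℂ) := by
    -- At -1 the characteristic polynomial is det(-1 - P) = (-1)ᵐ det(1 + P).
    have h := Matrix.eval_charpoly P (-1)
    rw [hP.isHermitian.charpoly_eq, Polynomial.eval_prod] at h
    have h1 : (Matrix.scalar (Fin m) (-1 : ℂ) - P) = -(1 + P) := by
      rw [map_neg, map_one]; abel
    rw [h1, Matrix.det_neg] at h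
    have h2 : ∏ i, Polynomial.eval (-1 : ℂ) (Polynomial.X - Polynomial.C (l i : ℂ)) =
        (-1) ^ m * ∏ i, (1 + (l i : ℂ)) := by
      have : ∀ i, Polynomial.eval (-1 : ℂ) (Polynomial.X - Polynomial.C (l i : ℂ)) =
        (-1) * (1 + (l i : ℂ)) := by intro i; simp; ring
      simp_rw [this, Finset.prod_mul_distrib]
      simp
    have h3 : ((-1 : ℂ) ^ m) * ∏ i, (1 + (l i : ℂ)) = (-1) ^ m * (1 + P).det := by
      rw [← h2]; simpa using h
    have := mul_left_cancel₀ (pow_ne_zero m (by norm_num)) h3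
    rw [← this]
    push_cast
    rfl
  have htr : P.trace.re = ∑ i, l i := by
    rw [hP.isHermitian.trace_eq_sum_eigenvalues]
    simp [l]
  have hre : (1 + P).det.re = ∏ i, (1 + l i) := by rw [hdet, Complex.ofReal_re]
  have hs : 0 ≤ ∑ i, l i := Finset.sum_nonneg fun i _ => hl i
  refine ⟨?_, by rw [hre, hdet], by rw [htr]; exact hs, ?_⟩
  · rw [hre]
    calc (1 : ℝ) = ∏ _i : Fin m, 1 := by simp
      _ ≤ _ := Finset.prod_le_prod (fun _ _ => zero_le_one) fun i _ => by linarith [hl i]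
  · rw [hre, htr, Real.log_prod fun i _ => by linarith [hl i]]
    calc ∑ i, Real.log (1 + l i) ≤ ∑ i : Fin m, Real.log (1 + ∑ j, l j) := by
          refine Finset.sum_le_sum fun i _ => Real.log_le_log (by linarith [hl i]) ?_
          have := Finset.single_le_sum (f := l) (fun j _ => hl j) (Finset.mem_univ i)
          linarith
      _ = _ := by simp

/-- `log (1 + Σ xᵢ) ≤ Σ log (1 + xᵢ)` for nonnegative `xᵢ`. -/
theorem log_one_add_sum_le {ι : Type*} (s : Finset ι) (x : ι → ℝ) (hx : ∀ i, 0 ≤ x i) :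
    Real.log (1 + ∑ i ∈ s, x i) ≤ ∑ i ∈ s, Real.log (1 + x i) := by
  rw [← Real.log_prod fun i _ => by linarith [hx i]]
  refine Real.log_le_log (by linarith [Finset.sum_nonneg fun i (_ : i ∈ s) => hx i]) ?_
  classical
  induction s using Finset.induction_on with
  | empty => simp
  | insert a s ha ih =>
    rw [Finset.sum_insert ha, Finset.prod_insert ha]
    have hs : 0 ≤ ∑ i ∈ s, x i := Finset.sum_nonneg fun i _ => hx i
    nlinarith [hx a, mul_nonneg (hx a) hs]

theorem one_add_mmseSINR {m n : ℕ} (H : Matrix (Fin m) (Fin (n + 1)) ℂ) (k : Fin (n + 1))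
    (ρ : ℝ) (hρ : 0 < ρ) :
    1 + ρ / (n + 1 : ℕ) * mmseNormalizedSINR H k ρ =
      (1 + ((ρ / (n + 1 : ℕ) : ℝ) : ℂ) • (H * Hᴴ)).det.re /
      (1 + ((ρ / (n + 1 : ℕ) : ℝ) : ℂ) •
        (H.submatrix id k.succAbove * (H.submatrix id k.succAbove)ᴴ)).det.re := by
  set c : ℝ := ρ / (n + 1 : ℕ) with hc
  have hc0 : 0 < c := by positivity
  set K := H.submatrix id k.succAbove
  set B : Matrix (Fin m) (Fin m) ℂ := 1 + (c : ℂ) • (K * Kᴴ) with hB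
  have hKK : removeCol H k * (removeCol H k)ᴴ = K * Kᴴ := by
    ext i j
    simp only [Matrix.mul_apply, removeCol, Matrix.submatrix_apply, Matrix.conjTranspose_apply,
      id, K]
    exact (Fintype.sum_equiv (finSuccAboveEquiv k) _ _ fun x => rfl).symm
  have hHH : H * Hᴴ = K * Kᴴ + Matrix.vecMulVec (H.col k) (star (H.col k)) := by
    ext i j
    simp [Matrix.mul_apply, Fin.sum_univ_succAbove _ k, K, Matrix.vecMulVec_apply, add_comm]
  obtain ⟨h1, h2, -, -⟩ := log_det_one_add ((c : ℂ) • (K * Kᴴ))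
    ((Matrix.posSemidef_self_mul_conjTranspose K).smul (by exact_mod_cast hc0.le))
  rw [← hB] at h1 h2
  have hdet0 : B.det ≠ 0 := by
    rw [h2]; exact_mod_cast (by linarith : B.det.re ≠ 0)
  have hdet : (1 + (c : ℂ) • (H * Hᴴ)).det =
      B.det * (1 + c * (star (H.col k) ⬝ᵥ (B⁻¹ *ᵥ H.col k))) := by
    have : (1 + (c : ℂ) • (H * Hᴴ)) = B + Matrix.replicateCol Unit ((c : ℂ) • H.col k) *
        Matrix.replicateRow Unit (star (H.col k)) := by
      rw [hHH, hB, smul_add, add_assoc, ← Matrix.vecMulVec_eq, Matrix.smul_vecMulVec]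
    rw [this, Matrix.det_add_replicateCol_mul_replicateRow (by simpa using hdet0),
      Matrix.mul_assoc, ← Matrix.replicateCol_mulVec, Matrix.det_unique (n := Unit)]
    congr 1
    change 1 + star (H.col k) ⬝ᵥ (B⁻¹ *ᵥ ((c : ℂ) • H.col k)) = _
    rw [Matrix.mulVec_smul, dotProduct_smul, smul_eq_mul]
  have hX : c * mmseNormalizedSINR H k ρ =
      c * (star (H.col k) ⬝ᵥ (B⁻¹ *ᵥ H.col k)).re := by
    rw [mmseNormalizedSINR, mmseSINR, hKK, ← hc, add_comm _ (1 : Matrix _ _ ℂ), ← hB, hc]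
    field_simp
  rw [hX, hdet]
  have hne : B.det.re ≠ 0 := by linarith
  rw [eq_div_iff hne, h2, Complex.re_ofReal_mul, Complex.ofReal_re, Complex.add_re,
    Complex.re_ofReal_mul, Complex.one_re, mul_comm]

/-! ### Law of the Gram determinant and of the inverse's diagonal -/

/-- The Gram matrix `H H†` of the rows of `H`. -/
def rowGram {m n : ℕ} (H : Fin m → Fin n → ℂ) : Matrix (Fin m) (Fin m) ℂ :=
  Matrix.of H * (Matrix.of H)ᴴ

theorem rowGram_posSemidef {m n : ℕ} (H : Fin m → Fin n → ℂ) : (rowGram H).PosSemidef :=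
  Matrix.posSemidef_self_mul_conjTranspose _

theorem continuous_rowGram {m n : ℕ} :
    Continuous (rowGram : (Fin m → Fin n → ℂ) → Matrix (Fin m) (Fin m) ℂ) := by
  have h : Continuous (fun H : Fin m → Fin n → ℂ => Matrix.of H) := continuous_id
  exact h.matrix_mul h.matrix_conjTranspose

theorem ofReal_det_rowGram {m n : ℕ} (H : Fin m → Fin n → ℂ) :
    (rowGram H).det = ((rowGram H).det.re : ℂ) :=
  Complex.ext rfl (by simpa using (Complex.nonneg_iff.mp (rowGram_posSemidef H).det_nonneg).2.symm)

@[fun_prop]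
theorem measurable_det_rowGram {m n : ℕ} :
    Measurable fun H : Fin m → Fin n → ℂ => (rowGram H).det.re :=
  (Complex.continuous_re.comp continuous_rowGram.matrix_det).measurable

theorem inv_apply_self {m : ℕ} (A : Matrix (Fin (m + 1)) (Fin (m + 1)) ℂ) (i : Fin (m + 1)) :
    A⁻¹ i i = (A.submatrix i.succAbove i.succAbove).det / A.det := by
  rw [Matrix.inv_def, Matrix.smul_apply, Matrix.adjugate_fin_succ_eq_det_submatrix,
    Ring.inverse_eq_inv', ← two_mul, pow_mul]
  simp [div_eq_inv_mul]

theorem rowGram_submatrix {m l n : ℕ} (H : Fin m → Fin n → ℂ) (e : Fin l → Fin m) :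
    (rowGram H).submatrix e e = rowGram fun i => H (e i) := by
  ext i j
  simp [rowGram, Matrix.mul_apply]

@[fun_prop]
theorem measurable_inv_rowGram_apply_self {m n : ℕ} (i : Fin m) :
    Measurable fun H : Fin m → Fin n → ℂ => ((rowGram H)⁻¹ i i).re := by
  cases m with
  | zero => exact i.elim0
  | succ m =>
    simp_rw [inv_apply_self]
    exact Complex.measurable_re.comp
      ((continuous_rowGram.matrix_submatrix _ _).matrix_det.measurable.div
        continuous_rowGram.matrix_det.measurable)

theorem det_rowGram_cons {m n : ℕ} (w : Fin (n + 1) → ℂ) (H : Fin m → Fin (n + 1) → ℂ) :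
    (rowGram (Fin.cons (Pi.single 0 (Real.sqrt (sqNorm w) : ℂ)) H :
      Fin (m + 1) → Fin (n + 1) → ℂ)).det =
    sqNorm w * (rowGram fun i j => H i (Fin.succ j)).det := by
  have h := det_gram_cons (Real.sqrt (sqNorm w) : ℂ) H
  rw [Complex.normSq_ofReal, Real.mul_self_sqrt (sqNorm_nonneg w)] at h
  exact h

/-- Bartlett's decomposition, one row at a time: after rotating the first row, the determinant
splits off its squared norm, and the remaining block is an independent Gaussian matrix with one row
and one column fewer. -/
theorem identDistrib_det_rowGram (m n : ℕ) :
    IdentDistrib (fun H : Fin (m + 1) → Fin (n + 1) → ℂ => (rowGram H).det.re)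
      (fun p : (Fin (n + 1) → ℂ) × (Fin m → Fin n → ℂ) => sqNorm p.1 * (rowGram p.2).det.re)
      (rayleighLaw (m + 1) (n + 1)) ((complexGaussianVector (n + 1)).prod (rayleighLaw m n)) := by
  have hm2 : Measurable fun p : (Fin (n + 1) → ℂ) × (Fin m → Fin n → ℂ) =>
      sqNorm p.1 * (rowGram p.2).det.re :=
    (measurable_sqNorm.comp measurable_fst).mul (measurable_det_rowGram.comp measurable_snd)
  refine ⟨measurable_det_rowGram.aemeasurable, hm2.aemeasurable, ?_⟩
  refine Measure.ext_of_lintegral _ fun f hf => ?_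
  rw [lintegral_map hf measurable_det_rowGram, lintegral_map hf hm2,
    lintegral_prod (fun p : (Fin (n + 1) → ℂ) × (Fin m → Fin n → ℂ) =>
      f (sqNorm p.1 * (rowGram p.2).det.re)) (hf.comp hm2).aemeasurable]
  refine (lintegral_rayleighLaw_succ (fun A => f A.det.re)
    (hf.comp measurable_det_rowGram)).trans ?_
  refine lintegral_congr fun w => ?_
  have h1 : ∀ H : Fin m → Fin (n + 1) → ℂ,
      (rowGram (Fin.cons (Pi.single 0 (Real.sqrt (sqNorm w) : ℂ)) H :
        Fin (m + 1) → Fin (n + 1) → ℂ)).det.re =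
      sqNorm w * (rowGram fun i j => H i (Fin.succAbove 0 j)).det.re := by
    intro H
    rw [det_rowGram_cons, Complex.re_ofReal_mul]
    rfl
  exact (lintegral_congr fun H => congrArg f (h1 H)).trans
    ((measurePreserving_removeCol m n 0).lintegral_comp
      (f := fun H => f (sqNorm w * (rowGram H).det.re)) (by fun_prop))

theorem rayleighLaw_ae_det_pos (m n N : ℕ) (hN : N = n + m) :
    ∀ᵐ H ∂rayleighLaw m N, 0 < (rowGram H).det.re := by
  subst hN
  induction m with
  | zero => exact ae_of_all _ fun H => by simp
  | succ m ih =>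
    refine (identDistrib_det_rowGram m (n + m)).symm.ae_snd (p := fun x => 0 < x)
      measurableSet_Ioi ?_
    have h1 := (Measure.quasiMeasurePreserving_fst (μ := complexGaussianVector (n + m + 1))
      (ν := rayleighLaw m (n + m))).ae (sqNorm_ae_pos (n + m))
    have h2 := (Measure.quasiMeasurePreserving_snd (μ := complexGaussianVector (n + m + 1))
      (ν := rayleighLaw m (n + m))).ae ih
    filter_upwards [h1, h2] with p hp1 hp2 using mul_pos hp1 hp2

theorem integrable_log_sqNorm (n : ℕ) :
    Integrable (fun w => Real.log (sqNorm w)) (complexGaussianVector (n + 1)) := by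
  have := integrable_log_gammaLaw n
  rw [← map_sqNorm] at this
  exact this.comp_measurable measurable_sqNorm

theorem integral_log_sqNorm (n : ℕ) :
    ∫ w, Real.log (sqNorm w) ∂complexGaussianVector (n + 1) = ∫ s, Real.log s ∂gammaLaw n := by
  rw [← map_sqNorm, integral_map measurable_sqNorm.aemeasurable
    Real.measurable_log.aestronglyMeasurable]

/-- The expected log-determinant of a complex Wishart matrix. -/
theorem integral_log_det_rowGram (m n N : ℕ) (hN : N = n + m) :
    Integrable (fun H => Real.log (rowGram H).det.re) (rayleighLaw m N) ∧
      ∫ H, Real.log (rowGram H).det.re ∂rayleighLaw m N =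
        ∑ i ∈ Finset.range m, ∫ s, Real.log s ∂gammaLaw (n + i) := by
  subst hN
  induction m with
  | zero => simp
  | succ m ih =>
    have hid := (identDistrib_det_rowGram m (n + m)).comp Real.measurable_log
    have h1 := (Measure.quasiMeasurePreserving_fst (μ := complexGaussianVector (n + m + 1))
      (ν := rayleighLaw m (n + m))).ae (sqNorm_ae_pos (n + m))
    have h2 := (Measure.quasiMeasurePreserving_snd (μ := complexGaussianVector (n + m + 1))
      (ν := rayleighLaw m (n + m))).ae (rayleighLaw_ae_det_pos m n _ rfl)
    have heq : (Real.log ∘ fun p : (Fin (n + m + 1) → ℂ) × (Fin m → Fin (n + m) → ℂ) =>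
        sqNorm p.1 * (rowGram p.2).det.re) =ᵐ[(complexGaussianVector (n + m + 1)).prod
          (rayleighLaw m (n + m))]
        fun p => Real.log (sqNorm p.1) + Real.log (rowGram p.2).det.re := by
      filter_upwards [h1, h2] with p hp1 hp2
      exact Real.log_mul hp1.ne' hp2.ne'
    have hi1 := (integrable_log_sqNorm (n + m)).comp_fst (rayleighLaw m (n + m))
    have hi2 := ih.1.comp_snd (complexGaussianVector (n + m + 1))
    refine ⟨hid.integrable_iff.mpr ((hi1.add hi2).congr heq.symm), ?_⟩
    refine hid.integral_eq.trans ?_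
    rw [integral_congr_ae heq, integral_add hi1 hi2, integral_fun_fst (fun w => Real.log (sqNorm w)),
      integral_fun_snd (fun H => Real.log (rowGram H).det.re), Finset.sum_range_succ,
      integral_log_sqNorm, ih.2]
    simp [add_comm]

/-- 1/(A⁻¹)ₗₗ is the squared distance from the last row to the span of the other m rows, a Gaussian
norm in N - m = n + 1 dimensions. Written as a ratio of Gram determinants, it is unchanged when the
first row is peeled off, since both contain the factor `sqNorm w`. -/
theorem lintegral_inv_rowGram_last (m n N : ℕ) (hN : N = n + m + 1) (f : ℝ → ENNReal)
    (hf : Measurable f) :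
    ∫⁻ H : Fin (m + 1) → Fin N → ℂ, f ((rowGram H)⁻¹ (Fin.last m) (Fin.last m)).re
        ∂rayleighLaw (m + 1) N =
      ∫⁻ s, f s⁻¹ ∂gammaLaw n := by
  subst hN
  induction m with
  | zero =>
    rw [← lintegral_sqNorm n (fun s => f s⁻¹) (hf.comp measurable_inv)]
    refine Eq.trans ?_ ((measurePreserving_eval
      (fun _ : Fin 1 => complexGaussianVector (n + 1)) 0).lintegral_comp
        (f := fun w => f (sqNorm w)⁻¹) (by fun_prop))
    refine lintegral_congr fun H => ?_
    congr 1
    have : (rowGram H).det = (sqNorm (H 0) : ℂ) := by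
      simp [rowGram, Matrix.mul_apply, sqNorm, Complex.mul_conj]
    rw [inv_apply_self, this, Matrix.det_isEmpty, one_div, ← Complex.ofReal_inv, Complex.ofReal_re]
  | succ m ih =>
    rw [← ih]
    refine (lintegral_rayleighLaw_succ
      (fun A => f (A⁻¹ (Fin.last (m + 1)) (Fin.last (m + 1))).re)
      (hf.comp (measurable_inv_rowGram_apply_self _))).trans ?_
    have h : ∀ᵐ w ∂complexGaussianVector (n + m + 1 + 1),
        ∫⁻ H : Fin (m + 1) → Fin (n + m + 1 + 1) → ℂ,
          f ((rowGram (Fin.cons (Pi.single 0 (Real.sqrt (sqNorm w) : ℂ)) H :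
            Fin (m + 1 + 1) → Fin (n + m + 1 + 1) → ℂ))⁻¹
              (Fin.last (m + 1)) (Fin.last (m + 1))).re ∂rayleighLaw (m + 1) (n + m + 1 + 1) =
        ∫⁻ H : Fin (m + 1) → Fin (n + m + 1) → ℂ,
          f ((rowGram H)⁻¹ (Fin.last m) (Fin.last m)).re ∂rayleighLaw (m + 1) (n + m + 1) := by
      filter_upwards [sqNorm_ae_pos (n + m + 1)] with w hw
      refine Eq.trans ?_ ((measurePreserving_removeCol (m + 1) (n + m + 1) 0).lintegral_comp
        (f := fun H => f ((rowGram H)⁻¹ (Fin.last m) (Fin.last m)).re) (by fun_prop))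
      refine lintegral_congr fun H => ?_
      congr 2
      have hsub : (fun i => (Fin.cons (Pi.single 0 (Real.sqrt (sqNorm w) : ℂ)) H :
          Fin (m + 1 + 1) → Fin (n + m + 1 + 1) → ℂ) ((Fin.last (m + 1)).succAbove i)) =
          Fin.cons (Pi.single 0 (Real.sqrt (sqNorm w) : ℂ))
            fun i => H ((Fin.last m).succAbove i) := by
        ext i : 1
        refine Fin.cases ?_ (fun i => ?_) i
        · simp
        · simp
      rw [inv_apply_self, rowGram_submatrix, hsub, det_rowGram_cons, det_rowGram_cons,
        mul_div_mul_left _ _ (by exact_mod_cast hw.ne'), inv_apply_self, rowGram_submatrix]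
      rfl
    refine (lintegral_congr_ae h).trans ?_
    simp

/-- The rows are exchangeable, so swapping row i with the last one suffices. -/
theorem lintegral_inv_rowGram_apply_self (m n N : ℕ) (hN : N = n + m + 1) (f : ℝ → ENNReal)
    (hf : Measurable f) (i : Fin (m + 1)) :
    ∫⁻ H : Fin (m + 1) → Fin N → ℂ, f ((rowGram H)⁻¹ i i).re ∂rayleighLaw (m + 1) N =
      ∫⁻ s, f s⁻¹ ∂gammaLaw n := by
  rw [← lintegral_inv_rowGram_last m n N hN f hf]
  refine Eq.trans ?_ ((measurePreserving_permRows (m + 1) N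
    (Equiv.swap i (Fin.last m))).lintegral_comp
      (f := fun H => f ((rowGram H)⁻¹ (Fin.last m) (Fin.last m)).re) (by fun_prop))
  refine lintegral_congr fun H => ?_
  rw [← rowGram_submatrix H (Equiv.swap i (Fin.last m)), Matrix.inv_submatrix_equiv]
  simp

/-! ### The high-SNR correction term -/

/-- The correction to the high-SNR expansion of the log-determinant. -/
def logDetGap {m n : ℕ} (c : ℝ) (H : Fin m → Fin n → ℂ) : ℝ :=
  Real.log (1 + (c : ℂ) • rowGram H).det.re - m * Real.log c - Real.log (rowGram H).det.re

/-- From 1 + cA = cA(1 + c⁻¹A⁻¹) the gap equals log det(1 + c⁻¹A⁻¹), which the trace bound controls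
through the diagonal of A⁻¹. -/
theorem logDetGap_mem {m n : ℕ} (c : ℝ) (hc : 0 < c) (H : Fin m → Fin n → ℂ)
    (hH : 0 < (rowGram H).det.re) :
    0 ≤ logDetGap c H ∧
      (∀ i, 0 ≤ ((rowGram H)⁻¹ i i).re) ∧
      logDetGap c H ≤ m * ∑ i, Real.log (1 + c⁻¹ * ((rowGram H)⁻¹ i i).re) := by
  set A := rowGram H with hA
  have hAdet : A.det ≠ 0 := by
    rw [hA, ofReal_det_rowGram]; exact_mod_cast hH.ne'
  have hinv : A⁻¹.PosSemidef := (rowGram_posSemidef H).inv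
  have hdiag : ∀ i, 0 ≤ (A⁻¹ i i).re := fun i => (Complex.nonneg_iff.mp hinv.diag_nonneg).1
  obtain ⟨h1, h2, h3, h4⟩ := log_det_one_add (((c⁻¹ : ℝ) : ℂ) • A⁻¹)
    (hinv.smul (by exact_mod_cast (inv_pos.mpr hc).le))
  have hfac : (1 + (c : ℂ) • A) = ((c : ℂ) • A) * (1 + ((c⁻¹ : ℝ) : ℂ) • A⁻¹) := by
    rw [mul_add, mul_one, Matrix.smul_mul, Matrix.mul_smul, smul_smul,
      Matrix.mul_nonsing_inv _ (by simpa using hAdet), add_comm]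
    have : (c : ℂ) ≠ 0 := by exact_mod_cast hc.ne'
    simp [this]
  have hdet : (1 + (c : ℂ) • A).det.re =
      c ^ m * A.det.re * (1 + ((c⁻¹ : ℝ) : ℂ) • A⁻¹).det.re := by
    rw [hfac, Matrix.det_mul, Matrix.det_smul, h2, hA, ofReal_det_rowGram]
    simp [← Complex.ofReal_pow]
  have hgap : logDetGap c H = Real.log (1 + ((c⁻¹ : ℝ) : ℂ) • A⁻¹).det.re := by
    rw [logDetGap, ← hA, hdet, Real.log_mul (by positivity) (by linarith),
      Real.log_mul (by positivity) (by positivity), Real.log_pow]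
    ring
  rw [hgap]
  refine ⟨Real.log_nonneg h1, hdiag, h4.trans ?_⟩
  have htr : (((c⁻¹ : ℝ) : ℂ) • A⁻¹).trace.re = ∑ i, c⁻¹ * (A⁻¹ i i).re := by
    simp only [Matrix.trace, Matrix.diag, Complex.re_sum, Matrix.smul_apply, smul_eq_mul,
      Complex.re_ofReal_mul]
  rw [htr]
  exact mul_le_mul_of_nonneg_left (log_one_add_sum_le _ _ fun i =>
    mul_nonneg (inv_pos.mpr hc).le (hdiag i)) (Nat.cast_nonneg m)

@[fun_prop]
theorem measurable_log_det_one_add {m n : ℕ} (c : ℝ) :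
    Measurable fun H : Fin m → Fin n → ℂ => Real.log (1 + (c : ℂ) • rowGram H).det.re := by
  have h1 : Continuous fun H : Fin m → Fin n → ℂ => (c : ℂ) • rowGram H := by
    have := continuous_rowGram (m := m) (n := n)
    fun_prop
  have h : Continuous fun H : Fin m → Fin n → ℂ => 1 + (c : ℂ) • rowGram H :=
    continuous_const.add h1
  exact Real.measurable_log.comp (Complex.continuous_re.comp h.matrix_det).measurable

theorem lintegral_logDetGap_le (m n N : ℕ) (hN : N = n + m) (c p : ℝ) (hc : 0 < c) (hp : 0 < p)
    (hp1 : p ≤ 1) (hpn : p < n + 1) :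
    ∫⁻ H, ENNReal.ofReal (logDetGap c H) ∂rayleighLaw m N ≤
      ENNReal.ofReal (m ^ 2 * (c⁻¹ ^ p * Real.Gamma (n + 1 - p) / p)) := by
  set B := c⁻¹ ^ p * Real.Gamma (n + 1 - p) / p with hB
  have hB0 : 0 ≤ B := by
    have := Real.Gamma_pos_of_pos (show 0 < (n : ℝ) + 1 - p by linarith)
    positivity
  have hrow : ∀ i : Fin m, ∫⁻ H : Fin m → Fin N → ℂ,
      ENNReal.ofReal (Real.log (1 + c⁻¹ * ((rowGram H)⁻¹ i i).re)) ∂rayleighLaw m N ≤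
        ENNReal.ofReal B := by
    intro i
    cases m with
    | zero => exact i.elim0
    | succ m =>
      rw [lintegral_inv_rowGram_apply_self m n N hN
        (fun x => ENNReal.ofReal (Real.log (1 + c⁻¹ * x))) (by fun_prop) i]
      exact lintegral_log_one_add_div_gammaLaw_le n c⁻¹ p (inv_pos.mpr hc) hp hp1 hpn
  calc _ ≤ ∫⁻ H : Fin m → Fin N → ℂ, (m : ENNReal) *
        ∑ i, ENNReal.ofReal (Real.log (1 + c⁻¹ * ((rowGram H)⁻¹ i i).re)) ∂rayleighLaw m N := by
        refine lintegral_mono_ae ?_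
        filter_upwards [rayleighLaw_ae_det_pos m n N hN] with H hH
        obtain ⟨-, hd, hle⟩ := logDetGap_mem c hc H hH
        refine (ENNReal.ofReal_le_ofReal hle).trans (le_of_eq ?_)
        rw [ENNReal.ofReal_mul (Nat.cast_nonneg m), ENNReal.ofReal_natCast,
          ENNReal.ofReal_sum_of_nonneg]
        intro i _
        exact Real.log_nonneg (by
          have := mul_nonneg (inv_pos.mpr hc).le (hd i)
          linarith)
    _ = m * ∑ i, ∫⁻ H : Fin m → Fin N → ℂ,
        ENNReal.ofReal (Real.log (1 + c⁻¹ * ((rowGram H)⁻¹ i i).re)) ∂rayleighLaw m N := by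
        rw [lintegral_const_mul _ (by fun_prop), lintegral_finsetSum _ (by fun_prop)]
    _ ≤ m * ∑ i : Fin m, ENNReal.ofReal B := by
        gcongr with i
        exact hrow i
    _ = _ := by
        rw [Finset.sum_const, Finset.card_univ, Fintype.card_fin, nsmul_eq_mul, ← mul_assoc,
          ENNReal.ofReal_mul (by positivity), ENNReal.ofReal_pow (by positivity),
          ENNReal.ofReal_natCast, sq]

theorem measurable_logDetGap {m n : ℕ} (c : ℝ) :
    Measurable (logDetGap c : (Fin m → Fin n → ℂ) → ℝ) := by
  unfold logDetGap
  fun_prop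

theorem integrable_logDetGap (m n N : ℕ) (hN : N = n + m) (c : ℝ) (hc : 0 < c) :
    Integrable (logDetGap c) (rayleighLaw m N) := by
  refine ⟨(measurable_logDetGap c).aestronglyMeasurable, ?_⟩
  have hnn : 0 ≤ᵐ[rayleighLaw m N] logDetGap c := by
    filter_upwards [rayleighLaw_ae_det_pos m n N hN] with H hH using (logDetGap_mem c hc H hH).1
  rw [hasFiniteIntegral_iff_ofReal hnn]
  -- The exponent 1/2 is admissible for every n, including n = 0.
  refine (lintegral_logDetGap_le m n N hN c (1 / 2) hc (by norm_num) (by norm_num) ?_).trans_lt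
    ENNReal.ofReal_lt_top
  have : (0 : ℝ) ≤ n := Nat.cast_nonneg n
  linarith

theorem integral_logDetGap_mem (m n N : ℕ) (hN : N = n + m) (c p : ℝ) (hc : 0 < c) (hp : 0 < p)
    (hp1 : p ≤ 1) (hpn : p < n + 1) :
    0 ≤ ∫ H, logDetGap c H ∂rayleighLaw m N ∧
      ∫ H, logDetGap c H ∂rayleighLaw m N ≤
        m ^ 2 * (c⁻¹ ^ p * Real.Gamma (n + 1 - p) / p) := by
  have hnn : 0 ≤ᵐ[rayleighLaw m N] logDetGap c := by
    filter_upwards [rayleighLaw_ae_det_pos m n N hN] with H hH using (logDetGap_mem c hc H hH).1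
  refine ⟨integral_nonneg_of_ae hnn, ?_⟩
  rw [integral_eq_lintegral_of_nonneg_ae hnn (measurable_logDetGap c).aestronglyMeasurable]
  refine ENNReal.toReal_le_of_le_ofReal ?_ (lintegral_logDetGap_le m n N hN c p hc hp hp1 hpn)
  have := Real.Gamma_pos_of_pos (show 0 < (n : ℝ) + 1 - p by linarith)
  positivity

theorem log_det_one_add_eq {m n : ℕ} (c : ℝ) (H : Fin m → Fin n → ℂ) :
    Real.log (1 + (c : ℂ) • rowGram H).det.re =
      logDetGap c H + m * Real.log c + Real.log (rowGram H).det.re := by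
  rw [logDetGap]; ring

theorem integral_log_det_one_add (m n N : ℕ) (hN : N = n + m) (c : ℝ) (hc : 0 < c) :
    Integrable (fun H => Real.log (1 + (c : ℂ) • rowGram H).det.re) (rayleighLaw m N) ∧
      ∫ H, Real.log (1 + (c : ℂ) • rowGram H).det.re ∂rayleighLaw m N =
        ∫ H, logDetGap c H ∂rayleighLaw m N + m * Real.log c +
          ∑ i ∈ Finset.range m, ∫ s, Real.log s ∂gammaLaw (n + i) := by
  have h1 := integrable_logDetGap m n N hN c hc
  obtain ⟨h2, h3⟩ := integral_log_det_rowGram m n N hN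
  have h4 : Integrable (fun H => logDetGap c H + m * Real.log c) (rayleighLaw m N) :=
    h1.add (integrable_const _)
  simp_rw [log_det_one_add_eq]
  refine ⟨h4.add h2, ?_⟩
  rw [integral_add h4 h2, integral_add h1 (integrable_const _), h3]
  simp

/-! ### The sum-rate, its limit and the error -/

theorem mmseRate_eq {m n : ℕ} (H : Fin m → Fin (n + 1) → ℂ) (k : Fin (n + 1)) (ρ : ℝ)
    (hρ : 0 < ρ) :
    mmseRate (Matrix.of H) k ρ =
      (Real.log (1 + ((ρ / (n + 1 : ℕ) : ℝ) : ℂ) • rowGram H).det.re -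
        Real.log (1 + ((ρ / (n + 1 : ℕ) : ℝ) : ℂ) •
          rowGram fun i j => H i (k.succAbove j)).det.re) / Real.log 2 := by
  have hc : (0 : ℝ) ≤ ρ / (n + 1 : ℕ) := by positivity
  have hpos : ∀ {l : ℕ} (K : Fin m → Fin l → ℂ),
      (1 + ((ρ / (n + 1 : ℕ) : ℝ) : ℂ) • rowGram K).det.re ≠ 0 := by
    intro l K
    have := (log_det_one_add (((ρ / (n + 1 : ℕ) : ℝ) : ℂ) • rowGram K)
      ((rowGram_posSemidef K).smul (by exact_mod_cast hc))).1
    linarith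
  rw [mmseRate, one_add_mmseSINR _ k ρ hρ, Real.logb, ← Real.log_div (hpos _) (hpos _)]
  rfl

theorem mmseSumRate_eq (m n : ℕ) (k : Fin (n + m + 1)) (ρ : ℝ) (hρ : 0 < ρ) :
    Integrable (fun H => mmseRate (Matrix.of H) k ρ) (rayleighLaw m (n + m + 1)) ∧
      mmseSumRate m (n + m + 1) k ρ -
        (∑ i ∈ Finset.range m, ((n + m + 1 : ℕ) : ℝ) / (((n + m + 1 : ℕ) : ℝ) - i - 1)) /
          Real.log 2 =
        (n + m + 1 : ℕ) / Real.log 2 *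
          (∫ H, logDetGap (ρ / (n + m + 1 : ℕ)) H ∂rayleighLaw m (n + m + 1) -
            ∫ H, logDetGap (ρ / (n + m + 1 : ℕ)) H ∂rayleighLaw m (n + m)) := by
  set c : ℝ := ρ / (n + m + 1 : ℕ) with hcdef
  have hc : 0 < c := by positivity
  obtain ⟨h1, h2⟩ := integral_log_det_one_add m (n + 1) (n + m + 1) (by omega) c hc
  obtain ⟨h3, h4⟩ := integral_log_det_one_add m n (n + m) rfl c hc
  have hp := measurePreserving_removeCol m (n + m) k
  have h5 : Integrable (fun H : Fin m → Fin (n + m + 1) → ℂ =>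
      Real.log (1 + (c : ℂ) • rowGram fun i j => H i (k.succAbove j)).det.re)
      (rayleighLaw m (n + m + 1)) := hp.integrable_comp_of_integrable h3
  have h6 : ∫ H : Fin m → Fin (n + m + 1) → ℂ,
      Real.log (1 + (c : ℂ) • rowGram fun i j => H i (k.succAbove j)).det.re
        ∂rayleighLaw m (n + m + 1) =
      ∫ H, Real.log (1 + (c : ℂ) • rowGram H).det.re ∂rayleighLaw m (n + m) := by
    rw [← hp.map_eq, integral_map hp.measurable.aemeasurable
      (measurable_log_det_one_add c).aestronglyMeasurable]
  have hfun : (fun H : Fin m → Fin (n + m + 1) → ℂ => mmseRate (Matrix.of H) k ρ) = fun H =>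
      (Real.log (1 + (c : ℂ) • rowGram H).det.re -
        Real.log (1 + (c : ℂ) • rowGram fun i j => H i (k.succAbove j)).det.re) /
          Real.log 2 := by
    ext H
    exact mmseRate_eq H k ρ hρ
  refine ⟨by rw [hfun]; exact (h1.sub h5).div_const _, ?_⟩
  have hsum : ∑ i ∈ Finset.range m, ∫ s, Real.log s ∂gammaLaw (n + 1 + i) -
      ∑ i ∈ Finset.range m, ∫ s, Real.log s ∂gammaLaw (n + i) =
      ∑ i ∈ Finset.range m, 1 / (((n + m + 1 : ℕ) : ℝ) - i - 1) := by
    -- Termwise the shapes differ by one; reversing the order matches 1/(n + j + 1) with 1/(Nt - i -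
    -- 1), where j = m - 1 - i.
    rw [← Finset.sum_sub_distrib, ← Finset.sum_range_reflect]
    refine Finset.sum_congr rfl fun i hi => ?_
    have hi' : i < m := Finset.mem_range.mp hi
    obtain ⟨j, rfl⟩ : ∃ j, m = i + 1 + j := ⟨m - (i + 1), by omega⟩
    rw [show i + 1 + j - 1 - i = j by omega, show n + 1 + j = n + j + 1 by omega,
      integral_log_gammaLaw_succ]
    push_cast
    rw [add_sub_cancel_left]
    congr 1
    ring
  have hsum2 : ∑ i ∈ Finset.range m, ((n + m + 1 : ℕ) : ℝ) / (((n + m + 1 : ℕ) : ℝ) - i - 1) =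
      (n + m + 1 : ℕ) *
        ∑ i ∈ Finset.range m, 1 / (((n + m + 1 : ℕ) : ℝ) - i - 1) := by
    rw [Finset.mul_sum]
    exact Finset.sum_congr rfl fun i _ => by rw [mul_one_div]
  rw [mmseSumRate, hfun, integral_div, integral_sub h1 h5, h6, h2, h4, hsum2, ← hsum]
  ring

/-- Convexity of Γ together with Γ(1) = Γ(2) = 1. -/
theorem Gamma_le_one_of_mem_Icc {x : ℝ} (h1 : 1 ≤ x) (h2 : x ≤ 2) : Real.Gamma x ≤ 1 := by
  have h := Real.convexOn_Gamma.2 (show (1 : ℝ) ∈ Set.Ioi 0 by simp)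
    (show (2 : ℝ) ∈ Set.Ioi 0 by simp) (show 0 ≤ 2 - x by linarith)
    (show 0 ≤ x - 1 by linarith) (by ring)
  simp only [smul_eq_mul, Real.Gamma_one, Real.Gamma_two] at h
  rw [show (2 - x) * 1 + (x - 1) * 2 = x by ring] at h
  linarith

theorem abs_mmseSumRate_sub_le (m n : ℕ) (k : Fin (n + m + 1)) (ρ p : ℝ) (hρ : 0 < ρ)
    (hp : 0 < p) (hp1 : p ≤ 1) (hpn : p < n + 1) :
    |mmseSumRate m (n + m + 1) k ρ -
        (∑ i ∈ Finset.range m, ((n + m + 1 : ℕ) : ℝ) / (((n + m + 1 : ℕ) : ℝ) - i - 1)) /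
          Real.log 2| ≤
      (n + m + 1 : ℕ) / Real.log 2 * (m ^ 2 * ((ρ / (n + m + 1 : ℕ))⁻¹ ^ p *
        (Real.Gamma (n + 2 - p) + Real.Gamma (n + 1 - p)) / p)) := by
  have hc : 0 < ρ / (n + m + 1 : ℕ) := by positivity
  obtain ⟨a1, a2⟩ := integral_logDetGap_mem m (n + 1) (n + m + 1) (by omega) _ p hc hp hp1
    (by push_cast; linarith)
  obtain ⟨b1, b2⟩ := integral_logDetGap_mem m n (n + m) rfl _ p hc hp hp1 hpn
  rw [(mmseSumRate_eq m n k ρ hρ).2, abs_mul,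
    abs_of_nonneg (div_nonneg (Nat.cast_nonneg _) (Real.log_nonneg one_le_two))]
  refine mul_le_mul_of_nonneg_left ?_
    (div_nonneg (Nat.cast_nonneg _) (Real.log_nonneg one_le_two))
  have e : ((n + 1 : ℕ) : ℝ) + 1 - p = n + 2 - p := by push_cast; ring
  rw [e] at a2
  have hsplit : ∀ q g1 g2 : ℝ, (m : ℝ) ^ 2 * (q * (g1 + g2) / p) =
      m ^ 2 * (q * g1 / p) + m ^ 2 * (q * g2 / p) := fun q g1 g2 => by ring
  rw [hsplit, abs_le]
  constructor <;> linarith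

/-- With one transmit antenna more than receive antennas, the error is `O(log ρ / ρ)`. -/
theorem mmseSumRate_sub_isBigO_log (m : ℕ) (k : Fin (0 + m + 1)) :
    (fun ρ : ℝ => mmseSumRate m (0 + m + 1) k ρ -
        (∑ i ∈ Finset.range m, ((0 + m + 1 : ℕ) : ℝ) / (((0 + m + 1 : ℕ) : ℝ) - i - 1)) /
          Real.log 2) =O[atTop] fun ρ => Real.log ρ / ρ := by
  set M : ℝ := ((0 + m + 1 : ℕ) : ℝ) with hM
  have hM1 : 1 ≤ M := by rw [hM]; push_cast; linarith [Nat.cast_nonneg (α := ℝ) m]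
  have hlog2 := Real.log_pos one_lt_two
  -- The 4 is 2 · 2: the two Gamma values add up to at most 2 log ρ, and 1/p ≤ 2.
  refine IsBigO.of_bound (M / Real.log 2 * (m ^ 2 * (M * Real.exp 1 * 4))) ?_
  -- This threshold forces L ≥ 2, hence p = 1 - 1/L ≥ 1/2.
  filter_upwards [eventually_ge_atTop (M * Real.exp 2)] with ρ hρ
  have hM0 : 0 < M := by linarith
  have hρ0 : 0 < ρ := lt_of_lt_of_le (by positivity) hρ
  have hc : 0 < ρ / M := by positivity
  set L := Real.log (ρ / M) with hL
  have hL2 : 2 ≤ L := by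
    rw [hL, Real.le_log_iff_exp_le hc, le_div_iff₀ hM0, mul_comm]
    exact hρ
  have hLρ : L ≤ Real.log ρ := Real.log_le_log hc (div_le_self hρ0.le hM1)
  have hLi : L⁻¹ ≤ 1 / 2 := by
    rw [one_div]; exact inv_anti₀ two_pos hL2
  have hLi0 : 0 < L⁻¹ := by positivity
  -- At p = 1 the bound would contain Γ(0). Backing off by 1/L costs only a factor e in c⁻ᵖ, while
  -- Γ(1 - p) = Γ(1/L) = L Γ(1 + 1/L) ≤ L.
  have h := abs_mmseSumRate_sub_le m 0 k ρ (1 - L⁻¹) hρ0 (by linarith) (by linarith)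
    (by push_cast; linarith)
  rw [Real.norm_eq_abs, Real.norm_eq_abs, abs_of_nonneg (a := Real.log ρ / ρ)
    (div_nonneg (by linarith) hρ0.le)]
  refine h.trans ?_
  rw [mul_assoc (M / Real.log 2), mul_assoc ((m : ℝ) ^ 2)]
  refine mul_le_mul_of_nonneg_left (mul_le_mul_of_nonneg_left ?_ (by positivity)) (by positivity)
  have hpow : (ρ / M)⁻¹ ^ (1 - L⁻¹) = M / ρ * Real.exp 1 := by
    rw [Real.rpow_def_of_pos (by positivity), Real.log_inv, ← hL,
      show -L * (1 - L⁻¹) = -L + 1 by field_simp; ring, Real.exp_add, Real.exp_neg, hL,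
      Real.exp_log hc, inv_div]
  have hG1 : Real.Gamma (((0 : ℕ) : ℝ) + 2 - (1 - L⁻¹)) ≤ 1 :=
    Gamma_le_one_of_mem_Icc (by push_cast; linarith) (by push_cast; linarith)
  have hG2 : Real.Gamma (((0 : ℕ) : ℝ) + 1 - (1 - L⁻¹)) ≤ L := by
    have e1 : ((0 : ℕ) : ℝ) + 1 - (1 - L⁻¹) = L⁻¹ := by push_cast; ring
    have e2 : ((0 : ℕ) : ℝ) + 2 - (1 - L⁻¹) = L⁻¹ + 1 := by push_cast; ring
    rw [e2, Real.Gamma_add_one hLi0.ne', inv_mul_le_iff₀ (by linarith)] at hG1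
    rw [e1]
    linarith
  have hG0 : 0 ≤ Real.Gamma (((0 : ℕ) : ℝ) + 2 - (1 - L⁻¹)) +
      Real.Gamma (((0 : ℕ) : ℝ) + 1 - (1 - L⁻¹)) :=
    add_nonneg (Real.Gamma_nonneg_of_nonneg (by push_cast; linarith))
      (Real.Gamma_nonneg_of_nonneg (by push_cast; linarith))
  rw [hpow, div_le_iff₀ (by linarith)]
  calc M / ρ * Real.exp 1 * (Real.Gamma (((0 : ℕ) : ℝ) + 2 - (1 - L⁻¹)) +
        Real.Gamma (((0 : ℕ) : ℝ) + 1 - (1 - L⁻¹)))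
      ≤ M / ρ * Real.exp 1 * (2 * Real.log ρ) := by
        refine mul_le_mul_of_nonneg_left ?_ (by positivity)
        linarith
    _ = M * Real.exp 1 * 4 * (Real.log ρ / ρ) * (1 / 2) := by ring
    _ ≤ _ := by
        refine mul_le_mul_of_nonneg_left (by linarith) ?_
        have : 0 ≤ Real.log ρ / ρ := div_nonneg (by linarith) hρ0.le
        positivity

/-- For n ≥ 1 the exponent p = 1 satisfies p < n + 1, so no logarithm is lost. -/
theorem mmseSumRate_sub_isBigO_inv (m n : ℕ) (hn : 1 ≤ n) (k : Fin (n + m + 1)) :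
    (fun ρ : ℝ => mmseSumRate m (n + m + 1) k ρ -
        (∑ i ∈ Finset.range m, ((n + m + 1 : ℕ) : ℝ) / (((n + m + 1 : ℕ) : ℝ) - i - 1)) /
          Real.log 2) =O[atTop] fun ρ => 1 / ρ := by
  refine IsBigO.of_bound ((n + m + 1 : ℕ) / Real.log 2 * (m ^ 2 * ((n + m + 1 : ℕ) *
        (Real.Gamma (n + 2 - 1) + Real.Gamma (n + 1 - 1))))) ?_
  filter_upwards [eventually_gt_atTop 0] with ρ hρ
  have hn' : (1 : ℝ) ≤ n := by exact_mod_cast hn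
  have h := abs_mmseSumRate_sub_le m n k ρ 1 hρ one_pos le_rfl (by linarith)
  rw [Real.norm_eq_abs, Real.norm_eq_abs, abs_of_pos (a := 1 / ρ) (by positivity)]
  refine h.trans (le_of_eq ?_)
  rw [Real.rpow_one]
  field_simp

theorem isLittleO_inv_log_div : (fun ρ : ℝ => 1 / ρ) =o[atTop] fun ρ => Real.log ρ / ρ := by
  have h : (fun _ : ℝ => (1 : ℝ)) =o[atTop] Real.log :=
    (isLittleO_const_left).mpr (Or.inr (tendsto_norm_atTop_atTop.comp Real.tendsto_log_atTop))
  simpa [div_eq_mul_inv] using h.mul_isBigO (isBigO_refl (fun ρ : ℝ => ρ⁻¹) atTop)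

end

theorem mainTheorem6 (Nr Nt : ℕ) (hN : Nr < Nt) (k : Fin Nt) :
    (∀ ρ : ℝ, 0 < ρ →
      Integrable (fun H => mmseRate (Matrix.of H) k ρ) (rayleighLaw Nr Nt)) ∧
    Tendsto (fun ρ : ℝ => mmseSumRate Nr Nt k ρ) atTop
      (𝓝 ((∑ i ∈ Finset.range Nr, (Nt : ℝ) / ((Nt : ℝ) - i - 1)) / Real.log 2)) ∧
    (fun ρ : ℝ => mmseSumRate Nr Nt k ρ
        - (∑ i ∈ Finset.range Nr, (Nt : ℝ) / ((Nt : ℝ) - i - 1)) / Real.log 2)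
      =O[atTop] (fun ρ : ℝ => Real.log ρ / ρ) ∧
    (Nr + 2 ≤ Nt →
      (fun ρ : ℝ => mmseSumRate Nr Nt k ρ
          - (∑ i ∈ Finset.range Nr, (Nt : ℝ) / ((Nt : ℝ) - i - 1)) / Real.log 2)
        =O[atTop] (fun ρ : ℝ => 1 / ρ) ∧
      (fun ρ : ℝ => mmseSumRate Nr Nt k ρ
          - (∑ i ∈ Finset.range Nr, (Nt : ℝ) / ((Nt : ℝ) - i - 1)) / Real.log 2)
        =o[atTop] (fun ρ : ℝ => Real.log ρ / ρ)) := by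
  -- Here n = 0 is exactly the case of a single surplus transmit antenna.
  obtain ⟨n, rfl⟩ : ∃ n, Nt = n + Nr + 1 := ⟨Nt - Nr - 1, by omega⟩
  have hlog : (fun ρ : ℝ => mmseSumRate Nr (n + Nr + 1) k ρ
      - (∑ i ∈ Finset.range Nr, ((n + Nr + 1 : ℕ) : ℝ) / (((n + Nr + 1 : ℕ) : ℝ) - i - 1)) /
        Real.log 2) =O[atTop] (fun ρ : ℝ => Real.log ρ / ρ) := by
    rcases Nat.eq_zero_or_pos n with rfl | hn
    · exact mmseSumRate_sub_isBigO_log Nr k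
    · exact (mmseSumRate_sub_isBigO_inv Nr n hn k).trans isLittleO_inv_log_div.isBigO
  refine ⟨fun ρ hρ => (mmseSumRate_eq Nr n k ρ hρ).1, ?_, hlog, fun h => ?_⟩
  · have h0 : Tendsto (fun ρ : ℝ => Real.log ρ / ρ) atTop (𝓝 0) :=
      Real.isLittleO_log_id_atTop.tendsto_div_nhds_zero
    exact tendsto_sub_nhds_zero_iff.mp (hlog.trans_tendsto h0)
  · have hO := mmseSumRate_sub_isBigO_inv Nr n (by omega) k
    exact ⟨hO, hO.trans_isLittleO isLittleO_inv_log_div⟩
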